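/- Let $m\ge 2$ be an integer. All cohomology groups are continuous cohomology groups with coefficients in $\mathbb Z/m$ with trivial action; in particular $H^1(\Gamma,\mathbb Z/m)$ is the group of continuous homomorphisms $\Gamma\to\mathbb Z/m$. **Kummer formations.** Let $G$ be a profinite group and $A$ a discrete $G$-module. For open normal subgroups $M\le M'$ of $G$ let $A^M$ be the subgroup of $M$-fixed elements, let $N_{M'/M}\colon A^M\to A^{M'}$, $a\mapsto\sum_{\sigma\in M'/M}\sigma a$, be the trace, let $I_{M'/M}\le A^M$ be the subgroup generated by all $\sigma a-a$ with $\sigma\in M'$, $a\in A^M$, and let $\hat H^{-1}(M'/M,A^M)=\operatorname{Ker}(N_{M'/M})/I_{M'/M}$. The group $G$ acts on $H^1(M,\mathbb Z/m)$ by $(g\omega)(h)=\omega(g^{-1}hg)$. An *$m$-Kummer formation* $(G,A,\{\kappa_M\}_M)$ consists of such $G$ and $A$ and, for each open normal subgroup $M$ of $G$, a $G$-equivariant epimorphism $\kappa_M\colon A^M\to H^1(M,\mathbb Z/m)$, such that for every such $M$: 1. for every $\chi\in H^1(M,\mathbb Z/m)$ the sequence $$H^1(\operatorname{Ker}\chi,\mathbb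 Z/m)\xrightarrow{\operatorname{Cor}}H^1(M,\mathbb Z/m)\xrightarrow{\cup\chi}H^2(M,\mathbb Z/m)\xrightarrow{\operatorname{Res}}H^2(\operatorname{Ker}\chi,\mathbb Z/m)$$ is exact; 2. $\operatorname{Ker}(\kappa_M)=mA^M$; 3. for every open normal subgroup $M'\ge M$ of $G$ one has $\kappa_M(a)=\operatorname{Res}_M(\kappa_{M'}(a))$ for all $a\in A^{M'}$, and $\kappa_{M'}(N_{M'/M}(a))=\operatorname{Cor}_{M'}(\kappa_M(a))$ for all $a\in A^M$; 4. for every open normal subgroup $M'\ge M$ of $G$ with $M'/M$ cyclic of order $m$ one has $\hat H^{-1}(M'/M,A^M)=0$. **Unitriangular matrices.** Let $\mathbb U_3(\mathbb Z/m)$ be the group of unipotent upper-triangular $4\times4$ matrices over $\mathbb Z/m$. The additive group $\mathbb Z/m$ embeds in it as a central subgroup by $a\mapsto I+aE_{1,4}$; let $\bar{\mathbb U}_3(\mathbb Z/m)$ be the quotient, a finite discrete group. The $(i,j)$-entries with $i<j$, $(i,j)\ne(1,4)$, are well defined on $\bar{\mathbb U}_3(\mathbb Z/m)$; for a homomorphism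 $\bar\rho$ into this group write $\bar\rho_{ij}$ for its composition with the $(i,j)$-entry. Let $\alpha\in H^2(\bar{\mathbb U}_3(\mathbb Z/m),\mathbb Z/m)$ be the class corresponding (under the Schreier correspondence) to the central extension $$0\to\mathbb Z/m\to\mathbb U_3(\mathbb Z/m)\to\bar{\mathbb U}_3(\mathbb Z/m)\to1.$$ **Theorem.** Let $G$ be the underlying group of an $m$-Kummer formation. Let $\chi_1,\chi_2,\chi_3\in H^1(G,\mathbb Z/m)$, where $\chi_1,\chi_3$ are $\mathbb Z/m$-linearly independent. If there exists a continuous homomorphism $\bar\rho\colon G\to\bar{\mathbb U}_3(\mathbb Z/m)$ with $\bar\rho_{i,i+1}=\chi_i$ for $i=1,2,3$, then there exists such a homomorphism for which in addition $\bar\rho^*\alpha=0$ in $H^2(G,\mathbb Z/m)$. -/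

import Mathlib

namespace KummerMassey

noncomputable section

/-! ## Continuous cohomology in degrees 1 and 2 with coefficients in `ℤ/m` (trivial action) -/

section Cohomology

variable (m : ℕ) (Γ : Type*) [Group Γ] [TopologicalSpace Γ]

/-- `H¹(Γ, ℤ/m)` for the trivial action: the continuous homomorphisms `Γ → ℤ/m`. -/
def H1 : Submodule (ZMod m) (Γ → ZMod m) where
  carrier := {f | Continuous f ∧ ∀ g h, f (g * h) = f g + f h}
  add_mem' := by
    rintro a b ⟨ha, ha'⟩ ⟨hb, hb'⟩
    refine ⟨ha.add hb, fun g h => ?_⟩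
    simp only [Pi.add_apply, ha', hb']
    ring
  zero_mem' := ⟨continuous_const, fun g h => by simp⟩
  smul_mem' := by
    rintro c a ⟨ha, ha'⟩
    refine ⟨continuous_const.mul ha, fun g h => ?_⟩
    simp only [Pi.smul_apply, ha', smul_eq_mul, mul_add]

/-- Continuous (inhomogeneous) `2`-cocycles `Γ × Γ → ℤ/m` for the trivial action. -/
def Z2 : Submodule (ZMod m) (Γ × Γ → ZMod m) where
  carrier := {f | Continuous f ∧
    ∀ g h k, f (g, h) + f (g * h, k) = f (h, k) + f (g, h * k)}
  add_mem' := by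
    rintro a b ⟨ha, ha'⟩ ⟨hb, hb'⟩
    refine ⟨ha.add hb, fun g h k => ?_⟩
    simp only [Pi.add_apply]
    linear_combination ha' g h k + hb' g h k
  zero_mem' := ⟨continuous_const, fun g h k => by simp⟩
  smul_mem' := by
    rintro c a ⟨ha, ha'⟩
    refine ⟨continuous_const.mul ha, fun g h k => ?_⟩
    simp only [Pi.smul_apply, smul_eq_mul]
    linear_combination c * ha' g h k

/-- `2`-coboundaries: the coboundaries of continuous `1`-cochains `Γ → ℤ/m`. -/
def B2 : Submodule (ZMod m) (Γ × Γ → ZMod m) where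
  carrier := {f | ∃ u : Γ → ZMod m, Continuous u ∧ ∀ g h, f (g, h) = u h - u (g * h) + u g}
  add_mem' := by
    rintro a b ⟨u, hu, hu'⟩ ⟨v, hv, hv'⟩
    refine ⟨u + v, hu.add hv, fun g h => ?_⟩
    simp only [Pi.add_apply, hu', hv']
    ring
  zero_mem' := ⟨0, continuous_const, fun g h => by simp⟩
  smul_mem' := by
    rintro c a ⟨u, hu, hu'⟩
    refine ⟨c • u, continuous_const.mul hu, fun g h => ?_⟩
    simp only [Pi.smul_apply, smul_eq_mul, hu']
    ring

/-- `H²(Γ, ℤ/m)`: continuous `2`-cocycles modulo coboundaries of continuous `1`-cochains. -/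
abbrev H2 : Type _ := Z2 m Γ ⧸ (B2 m Γ).comap (Z2 m Γ).subtype

variable {m Γ}

/-- The cohomology class of a continuous `2`-cocycle. -/
def H2.mk (f : Z2 m Γ) : H2 m Γ := Submodule.Quotient.mk f

variable {Δ : Type*} [Group Δ] [TopologicalSpace Δ]

/-- Pullback of `H¹` along a continuous homomorphism. -/
def H1.map (φ : Γ →ₜ* Δ) : H1 m Δ →ₗ[ZMod m] H1 m Γ where
  toFun f := ⟨fun g => f.1 (φ g), f.2.1.comp φ.continuous_toFun,
    fun g h => by simp only [map_mul, f.2.2]⟩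
  map_add' _ _ := rfl
  map_smul' _ _ := rfl

/-- Pullback of continuous `2`-cocycles along a continuous homomorphism. -/
def Z2.map (φ : Γ →ₜ* Δ) : Z2 m Δ →ₗ[ZMod m] Z2 m Γ where
  toFun f := ⟨fun p => f.1 (φ p.1, φ p.2),
    f.2.1.comp ((φ.continuous_toFun.comp continuous_fst).prodMk
      (φ.continuous_toFun.comp continuous_snd)),
    fun g h k => by simpa only [map_mul] using f.2.2 (φ g) (φ h) (φ k)⟩
  map_add' _ _ := rfl
  map_smul' _ _ := rfl

/-- The functorially induced map `φ^* : H²(Δ, ℤ/m) → H²(Γ, ℤ/m)`. -/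
def H2.map (φ : Γ →ₜ* Δ) : H2 m Δ →ₗ[ZMod m] H2 m Γ :=
  Submodule.mapQ _ _ (Z2.map φ) (by
    rintro f ⟨u, hu, hu'⟩
    refine ⟨fun g => u (φ g), hu.comp φ.continuous_toFun, fun g h => ?_⟩
    have := hu' (φ g) (φ h)
    rw [← map_mul] at this
    exact this)

/-- The inclusion of a subgroup, as a continuous homomorphism. -/
def incl (H : Subgroup Γ) : H →ₜ* Γ where
  toMonoidHom := H.subtype
  continuous_toFun := continuous_subtype_val

/-- The inclusion `H → K` of subgroups `H ≤ K`, as a continuous homomorphism. -/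
def inclLE {H K : Subgroup Γ} (h : H ≤ K) : H →ₜ* K where
  toMonoidHom := Subgroup.inclusion h
  continuous_toFun := continuous_subtype_val.subtype_mk _

/-- For `H ≤ K ≤ Γ`, the identification of `H`, regarded as a subgroup of `K`, with `H`. -/
def ofSubgroupOf {H K : Subgroup Γ} (h : H ≤ K) : H.subgroupOf K →ₜ* H where
  toMonoidHom := (Subgroup.subgroupOfEquivOfLe h).toMonoidHom
  continuous_toFun :=
    (continuous_subtype_val.comp continuous_subtype_val).subtype_mk _

/-- The cup product `H¹(Γ, ℤ/m) → H²(Γ, ℤ/m)`, `η ↦ η ∪ χ`, where `η ∪ χ` is the class of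
`(g, h) ↦ η(g) χ(h)`. -/
def cup (η χ : H1 m Γ) : H2 m Γ :=
  H2.mk ⟨fun p => η.1 p.1 * χ.1 p.2,
    (η.2.1.comp continuous_fst).mul (χ.2.1.comp continuous_snd),
    fun g h k => by
      simp only [η.2.2, χ.2.2]
      ring⟩

/-- A class in `H¹(Γ, ℤ/m)` as a homomorphism to the multiplicative copy of `ℤ/m`. -/
def H1.toHom (χ : H1 m Γ) : Γ →* Multiplicative (ZMod m) :=
  MonoidHom.mk' (fun g => Multiplicative.ofAdd (χ.1 g)) (fun g h => by rw [χ.2.2, ofAdd_add])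

/-- The kernel of a class in `H¹(Γ, ℤ/m)`. -/
def H1.ker (χ : H1 m Γ) : Subgroup Γ := (H1.toHom χ).ker

lemma H1.mem_ker (χ : H1 m Γ) (g : Γ) : g ∈ H1.ker χ ↔ χ.1 g = 0 := by
  rw [H1.ker, MonoidHom.mem_ker]
  exact ofAdd_eq_one

lemma H1.isOpen_ker (χ : H1 m Γ) : IsOpen (H1.ker χ : Set Γ) := by
  have : (H1.ker χ : Set Γ) = χ.1 ⁻¹' {0} := by
    ext g
    simp [H1.mem_ker]
  rw [this]
  exact (isOpen_discrete _).preimage χ.2.1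

instance H1.finiteIndex_ker [NeZero m] (χ : H1 m Γ) : (H1.ker χ).FiniteIndex := by
  have : Finite (Multiplicative (ZMod m)) := inferInstanceAs (Finite (ZMod m))
  exact Subgroup.finiteIndex_ker (H1.toHom χ)

lemma continuous_transfer [IsTopologicalGroup Γ] (H : Subgroup Γ) (hH : IsOpen (H : Set Γ))
    [H.FiniteIndex] (χ : H1 m H) :
    Continuous fun g : Γ => Multiplicative.toAdd (MonoidHom.transfer (H1.toHom χ) g) := by
  let T : H.LeftTransversal := default
  let r : Γ ⧸ H → Γ := fun q => (T.2.leftQuotientEquiv q : Γ)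
  have hr : ∀ q, (r q : Γ ⧸ H) = q := fun q => T.2.leftQuotientEquiv.symm_apply_apply q
  let V : Set Γ := ⋂ q : Γ ⧸ H, (fun g => (r q)⁻¹ * g * r q) ⁻¹'
    ((fun x : H => (x : Γ)) '' (H1.ker χ : Set H))
  have hV : IsOpen V := by
    have : Finite (Γ ⧸ H) := inferInstance
    refine isOpen_iInter_of_finite fun q => ?_
    exact (hH.isOpenMap_subtype_val _ (H1.isOpen_ker χ)).preimage (by fun_prop)
  have h1 : (1 : Γ) ∈ V := by
    refine Set.mem_iInter.2 fun q => ⟨1, one_mem _, by simp⟩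
  have hker : ∀ g ∈ V, MonoidHom.transfer (H1.toHom χ) g = 1 := by
    intro g hg
    rw [MonoidHom.transfer_def (H1.toHom χ) T]
    refine Finset.prod_eq_one fun q _ => ?_
    obtain ⟨x, hx, hxg⟩ := Set.mem_iInter.1 hg q
    have hfix : g⁻¹ • q = q := by
      rw [inv_smul_eq_iff]
      conv_rhs => rw [← hr q]
      conv_lhs => rw [← hr q]
      refine (QuotientGroup.eq (s := H)).2 ?_
      have : (r q)⁻¹ * (g * r q) = (x : Γ) := by
        rw [← mul_assoc]
        exact hxg.symm
      change (r q)⁻¹ * (g * r q) ∈ H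
      rw [this]
      exact x.2
    have hval : ((g • T).2.leftQuotientEquiv q : Γ) = g * r q := by
      rw [Subgroup.smul_apply_eq_smul_apply_inv_smul, hfix, smul_eq_mul]
    have : (⟨(T.2.leftQuotientEquiv q : Γ)⁻¹ * ((g • T).2.leftQuotientEquiv q : Γ),
        QuotientGroup.leftRel_apply.mp <| Quotient.exact'
          ((T.2.leftQuotientEquiv.symm_apply_apply q).trans
            ((g • T).2.leftQuotientEquiv.symm_apply_apply q).symm)⟩ : H) = x := by
      refine Subtype.ext ?_
      change (r q)⁻¹ * ((g • T).2.leftQuotientEquiv q : Γ) = (x : Γ)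
      rw [hval, ← mul_assoc]
      exact hxg.symm
    exact (congrArg (H1.toHom χ) this).trans hx
  refine continuous_iff_continuousAt.2 fun g => ?_
  rw [ContinuousAt, nhds_discrete (ZMod m), Filter.tendsto_pure]
  have hmem : (fun y => g⁻¹ * y) ⁻¹' V ∈ nhds g :=
    (hV.preimage (by fun_prop)).mem_nhds (by simpa using h1)
  filter_upwards [hmem] with y hy
  have := hker _ hy
  rw [map_mul, map_inv, inv_mul_eq_one] at this
  rw [this]

/-- The corestriction `H¹(H, ℤ/m) → H¹(Γ, ℤ/m)` for an open subgroup `H` of finite index: it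
sends a homomorphism `χ` to its transfer `g ↦ ∑_{c ∈ Γ/H} χ(r(gc)⁻¹ g r(c))`, where `r` is a
system of representatives of the cosets `c ∈ Γ/H`. -/
def cor [IsTopologicalGroup Γ] (H : Subgroup Γ) (hH : IsOpen (H : Set Γ)) [H.FiniteIndex] :
    H1 m H →+ H1 m Γ where
  toFun χ := ⟨fun g => Multiplicative.toAdd (MonoidHom.transfer (H1.toHom χ) g),
    continuous_transfer H hH χ, fun g h =>
      congrArg Multiplicative.toAdd ((MonoidHom.transfer (H1.toHom χ)).map_mul g h)⟩
  map_zero' := by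
    refine Subtype.ext (funext fun g => ?_)
    change Multiplicative.toAdd _ = Multiplicative.toAdd (1 : Multiplicative (ZMod m))
    refine congrArg _ ?_
    exact Finset.prod_eq_one fun q _ => rfl
  map_add' χ ψ := by
    refine Subtype.ext (funext fun g => ?_)
    change Multiplicative.toAdd _ = Multiplicative.toAdd
      (MonoidHom.transfer (H1.toHom χ) g * MonoidHom.transfer (H1.toHom ψ) g)
    refine congrArg _ ?_
    exact Finset.prod_mul_distrib

/-- For a normal subgroup `M`, the conjugation `h ↦ g h g⁻¹` of `M`. -/
def conjHom [IsTopologicalGroup Γ] (M : Subgroup Γ) [M.Normal] (g : Γ) : M →ₜ* M where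
  toMonoidHom := (MulAut.conjNormal g : M ≃* M).toMonoidHom
  continuous_toFun :=
    ((continuous_const.mul continuous_subtype_val).mul continuous_const).subtype_mk _

/-- The action of `g ∈ Γ` on `H¹(M, ℤ/m)` for a normal subgroup `M`:
`(g ω)(h) = ω(g⁻¹ h g)`. -/
def conj [IsTopologicalGroup Γ] (M : Subgroup Γ) [M.Normal] (g : Γ) (ω : H1 m M) : H1 m M :=
  H1.map (conjHom M g⁻¹) ω

lemma conj_apply [IsTopologicalGroup Γ] (M : Subgroup Γ) [hM : M.Normal] (g : Γ) (ω : H1 m M)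
    (h : M) : (conj M g ω).1 h =
      ω.1 ⟨g⁻¹ * h * g, by simpa using hM.conj_mem h h.2 g⁻¹⟩ := by
  refine congrArg ω.1 (Subtype.ext ?_)
  exact congrArg (g⁻¹ * (h : Γ) * ·) (inv_inv g)

end Cohomology

/-! ## Kummer formations -/

section Kummer

variable {G : Type*} [Group G]
variable (A : Type*) [AddCommGroup A] [DistribMulAction G A]

/-- `A^M`, the subgroup of elements fixed by the subgroup `M`. -/
abbrev fixed (M : Subgroup G) : AddSubgroup A := FixedPoints.addSubgroup M A

variable {A}

lemma smul_mem_fixed {M : Subgroup G} [hM : M.Normal] (g : G) {a : A} (ha : a ∈ fixed A M) :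
    g • a ∈ fixed A M := by
  intro h
  have := ha ⟨g⁻¹ * h * g, by simpa using hM.conj_mem h h.2 g⁻¹⟩
  rw [Subgroup.smul_def] at this ⊢
  simp only [mul_smul] at this
  rw [inv_smul_eq_iff] at this
  exact this

lemma fixed_anti {M M' : Subgroup G} (h : M ≤ M') : fixed A M' ≤ fixed A M :=
  fun _ ha x => ha ⟨x.1, h x.2⟩

/-- For `a ∈ A^M` and a coset `q = σM` of `M` in `M'`, the element `σ a`. -/
def cosetSmul {M M' : Subgroup G} (a : fixed A M) (q : M' ⧸ M.subgroupOf M') : A :=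
  Quotient.liftOn' q (fun σ => (σ : G) • (a : A)) (by
    intro σ τ h
    rw [QuotientGroup.leftRel_apply, Subgroup.mem_subgroupOf] at h
    have := a.2 ⟨_, h⟩
    rw [Subgroup.smul_def] at this
    simp only [Subgroup.coe_mul, Subgroup.coe_inv, mul_smul] at this
    rw [inv_smul_eq_iff] at this
    exact this.symm)

lemma cosetSmul_smul {M M' : Subgroup G} (a : fixed A M) (τ : M')
    (q : M' ⧸ M.subgroupOf M') : cosetSmul a (τ • q) = τ • cosetSmul a q := by
  induction q using QuotientGroup.induction_on with
  | H σ => exact mul_smul (τ : G) (σ : G) (a : A)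

/-- The trace `N_{M'/M} : A^M → A^{M'}`, `a ↦ ∑_{σ ∈ M'/M} σ a`, for `M ≤ M'` of finite index. -/
def trace (M M' : Subgroup G) [(M.subgroupOf M').FiniteIndex] : fixed A M →+ fixed A M' where
  toFun a := ⟨∑ᶠ q : M' ⧸ M.subgroupOf M', cosetSmul a q, by
    have : Fintype (M' ⧸ M.subgroupOf M') := Fintype.ofFinite _
    intro τ
    rw [finsum_eq_sum_of_fintype, Finset.smul_sum]
    refine Fintype.sum_equiv (MulAction.toPerm τ) _ _ fun q => ?_
    exact (cosetSmul_smul a τ q).symm⟩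
  map_zero' := by
    refine Subtype.ext ?_
    refine finsum_eq_zero_of_forall_eq_zero fun q => ?_
    induction q using QuotientGroup.induction_on with
    | H σ => exact smul_zero (σ : G)
  map_add' a b := by
    refine Subtype.ext ?_
    change _ = (∑ᶠ q, cosetSmul a q) + ∑ᶠ q, cosetSmul b q
    rw [← finsum_add_distrib (Set.toFinite _) (Set.toFinite _)]
    refine finsum_congr fun q => ?_
    induction q using QuotientGroup.induction_on with
    | H σ => exact smul_add (σ : G) (a : A) (b : A)

/-- The subgroup `I_{M'/M}` of `A^M` generated by the elements `σ a - a`, with `σ ∈ M'` and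
`a ∈ A^M`. -/
def augmentation (M M' : Subgroup G) [M.Normal] : AddSubgroup (fixed A M) :=
  AddSubgroup.closure
    {x | ∃ σ ∈ M', ∃ a : fixed A M, x = ⟨σ • (a : A), smul_mem_fixed σ a.2⟩ - a}

/-- The Tate cohomology group `Ĥ⁻¹(M'/M, A^M) = Ker(N_{M'/M}) / I_{M'/M}`. -/
abbrev TateHNegOne (A : Type*) [AddCommGroup A] [DistribMulAction G A] (M M' : Subgroup G)
    [M.Normal] [(M.subgroupOf M').FiniteIndex] : Type _ :=
  (trace (A := A) M M').ker ⧸ (augmentation (A := A) M M').addSubgroupOf (trace M M').ker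

variable [TopologicalSpace G] [IsTopologicalGroup G] [CompactSpace G]

instance finiteIndex_openNormal (M : OpenNormalSubgroup G) : M.toSubgroup.FiniteIndex := by
  have := M.toSubgroup.quotient_finite_of_isOpen M.isOpen'
  exact Subgroup.finiteIndex_of_finite_quotient

/-- Corestriction `H¹(M, ℤ/m) → H¹(M', ℤ/m)` for open normal subgroups `M ≤ M'`. -/
def corLE {m : ℕ} {M M' : OpenNormalSubgroup G} (h : M.toSubgroup ≤ M'.toSubgroup) :
    H1 m M.toSubgroup →+ H1 m M'.toSubgroup :=
  (cor (M.toSubgroup.subgroupOf M'.toSubgroup)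
    (M.isOpen'.preimage continuous_subtype_val)).comp
    (H1.map (ofSubgroupOf h)).toAddMonoidHom

/-- The maps `κ_M` of an `m`-Kummer formation `(G, A, {κ_M}_M)`, with their defining properties,
for a profinite group `G` and a discrete `G`-module `A`. -/
structure KummerFormation (m : ℕ) [NeZero m] (G : Type*) [Group G] [TopologicalSpace G]
    [IsTopologicalGroup G] [CompactSpace G] [TotallyDisconnectedSpace G]
    (A : Type*) [AddCommGroup A] [TopologicalSpace A] [DiscreteTopology A]
    [DistribMulAction G A] [ContinuousSMul G A] where
  /-- The homomorphism `κ_M : A^M → H¹(M, ℤ/m)` for each open normal subgroup `M`. -/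
  κ (M : OpenNormalSubgroup G) : fixed A M.toSubgroup →+ H1 m M.toSubgroup
  surjective (M : OpenNormalSubgroup G) : Function.Surjective (κ M)
  equivariant (M : OpenNormalSubgroup G) (g : G) (a : fixed A M.toSubgroup) :
    κ M ⟨g • (a : A), smul_mem_fixed g a.2⟩ = conj M.toSubgroup g (κ M a)
  /-- Exactness of `H¹(Ker χ) → H¹(M) → H²(M)` (corestriction, then cup product with `χ`). -/
  exact_cor_cup (M : OpenNormalSubgroup G) (χ : H1 m M.toSubgroup) :
    Function.Exact (cor (H1.ker χ) (H1.isOpen_ker χ)) (fun η : H1 m M.toSubgroup => cup η χ)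
  /-- Exactness of `H¹(M) → H²(M) → H²(Ker χ)` (cup product with `χ`, then restriction). -/
  exact_cup_res (M : OpenNormalSubgroup G) (χ : H1 m M.toSubgroup) :
    Function.Exact (fun η : H1 m M.toSubgroup => cup η χ) (H2.map (m := m) (incl (H1.ker χ)))
  /-- `Ker κ_M = m A^M`. -/
  ker_eq (M : OpenNormalSubgroup G) (a : fixed A M.toSubgroup) :
    κ M a = 0 ↔ ∃ b : fixed A M.toSubgroup, a = m • b
  /-- Compatibility of `κ` with inclusions and restrictions. -/
  res_comm (M M' : OpenNormalSubgroup G) (h : M.toSubgroup ≤ M'.toSubgroup)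
    (a : fixed A M'.toSubgroup) :
    κ M ⟨a, fixed_anti h a.2⟩ = H1.map (inclLE h) (κ M' a)
  /-- Compatibility of `κ` with traces and corestrictions. -/
  cor_comm (M M' : OpenNormalSubgroup G) (h : M.toSubgroup ≤ M'.toSubgroup)
    (a : fixed A M.toSubgroup) :
    κ M' (trace M.toSubgroup M'.toSubgroup a) = corLE h (κ M a)
  /-- Vanishing of `Ĥ⁻¹(M'/M, A^M)` when `M'/M` is cyclic of order `m`. -/
  tate_vanishing (M M' : OpenNormalSubgroup G) (h : M.toSubgroup ≤ M'.toSubgroup)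
    (hcyc : IsCyclic (M'.toSubgroup ⧸ M.toSubgroup.subgroupOf M'.toSubgroup))
    (hcard : Nat.card (M'.toSubgroup ⧸ M.toSubgroup.subgroupOf M'.toSubgroup) = m) :
    Subsingleton (TateHNegOne A M.toSubgroup M'.toSubgroup)

end Kummer

/-! ## Unitriangular matrices -/

section Unitriangular

variable (n : ℕ) (R : Type*) [CommRing R]

/-- The group `𝕌_n(R)` of unipotent upper-triangular `(n+1) × (n+1)`-matrices over `R`. -/
def U : Subgroup (GL (Fin (n + 1)) R) where
  carrier := {M | (∀ i, M.1 i i = 1) ∧ ∀ i j, j < i → M.1 i j = 0}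
  one_mem' := ⟨fun i => by simp, fun i j h => by simp [Matrix.one_apply_ne h.ne']⟩
  mul_mem' := by
    rintro M N ⟨hM, hM'⟩ ⟨hN, hN'⟩
    refine ⟨fun i => ?_, fun i j hij => ?_⟩
    · rw [Units.val_mul, Matrix.mul_apply, Finset.sum_eq_single i, hM, hN, mul_one]
      · intro k _ hk
        rcases lt_or_gt_of_ne hk with h | h
        · rw [hM' i k h, zero_mul]
        · rw [hN' k i h, mul_zero]
      · simp
    · rw [Units.val_mul, Matrix.mul_apply]
      refine Finset.sum_eq_zero fun k _ => ?_
      rcases lt_or_ge k i with h | h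
      · rw [hM' i k h, zero_mul]
      · rw [hN' k j (hij.trans_le h), mul_zero]
  inv_mem' := by
    rintro M ⟨hM, hM'⟩
    have hinv : (M⁻¹).1.BlockTriangular id := by
      have : Invertible M.1 := M.invertible
      have h := Matrix.blockTriangular_inv_of_blockTriangular (M := M.1) (b := id)
        (fun i j h => hM' i j h)
      rwa [← Matrix.coe_units_inv] at h
    refine ⟨fun i => ?_, fun i j hij => hinv hij⟩
    have h1 : (M.1 * (M⁻¹).1) i i = 1 := by rw [Units.mul_inv, Matrix.one_apply_eq]
    rw [Matrix.mul_apply, Finset.sum_eq_single i, hM, one_mul] at h1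
    · exact h1
    · intro k _ hk
      rcases lt_or_gt_of_ne hk with h | h
      · rw [hM' i k h, zero_mul]
      · rw [hinv h, mul_zero]
    · simp

variable {n R}

/-- The `(i, j)`-entry of a unitriangular matrix. -/
def U.entry (i j : Fin (n + 1)) (M : U n R) : R := M.1.1 i j

variable (n R)

lemma mul_single_corner (M : U n R) (a : R) :
    M.1.1 * Matrix.single 0 (Fin.last n) a = Matrix.single 0 (Fin.last n) a := by
  ext i j
  by_cases hj : j = Fin.last n
  · subst hj
    rw [Matrix.mul_single_apply_same]
    rcases (Fin.zero_le i).eq_or_lt with rfl | hi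
    · simp [M.2.1]
    · rw [M.2.2 i 0 hi, zero_mul, Matrix.single_apply_of_ne]
      exact fun h => hi.ne h.1
  · rw [Matrix.mul_single_apply_of_ne _ _ _ _ _ hj, Matrix.single_apply_of_ne]
    exact fun h => hj h.2.symm

lemma single_corner_mul (M : U n R) (a : R) :
    Matrix.single (0 : Fin (n + 1)) (Fin.last n) a * M.1.1 =
      Matrix.single 0 (Fin.last n) a := by
  ext i j
  by_cases hi : i = 0
  · subst hi
    rw [Matrix.single_mul_apply_same]
    rcases (Fin.le_last j).eq_or_lt with rfl | hj
    · simp [M.2.1]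
    · rw [M.2.2 _ j hj, mul_zero, Matrix.single_apply_of_ne]
      exact fun h => hj.ne h.2.symm
  · rw [Matrix.single_mul_apply_of_ne _ _ _ _ _ hi, Matrix.single_apply_of_ne]
    exact fun h => hi h.1.symm

variable [NeZero n]

lemma zero_ne_last : (0 : Fin (n + 1)) ≠ Fin.last n := by
  have := NeZero.ne n
  intro h
  have := congrArg Fin.val h
  simp at this
  omega

/-- The embedding `R⁺ → 𝕌_n(R)`, `a ↦ I + a E_{1,n+1}`. -/
def corner : Multiplicative R →* U n R where
  toFun a := ⟨⟨1 + Matrix.single 0 (Fin.last n) a.toAdd,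
      1 + Matrix.single 0 (Fin.last n) (-a.toAdd),
      by simp [mul_add, add_mul, (zero_ne_last n).symm, add_assoc,
        ← Matrix.single_add],
      by simp [mul_add, add_mul, (zero_ne_last n).symm, add_assoc,
        ← Matrix.single_add]⟩, by
    have h0 := zero_ne_last n
    refine ⟨fun i => ?_, fun i j hij => ?_⟩
    · change (1 + Matrix.single 0 (Fin.last n) a.toAdd : Matrix _ _ R) i i = 1
      rw [Matrix.add_apply, Matrix.one_apply_eq, Matrix.single_apply_of_ne, add_zero]
      rintro ⟨rfl, h⟩
      exact h0 h.symm
    · change (1 + Matrix.single 0 (Fin.last n) a.toAdd : Matrix _ _ R) i j = 0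
      rw [Matrix.add_apply, Matrix.one_apply_ne hij.ne', Matrix.single_apply_of_ne, add_zero]
      rintro ⟨rfl, rfl⟩
      exact absurd hij (Fin.zero_le _).not_gt⟩
  map_one' := by
    refine Subtype.ext (Units.ext ?_)
    simp
  map_mul' a b := by
    refine Subtype.ext (Units.ext ?_)
    simp [mul_add, add_mul, (zero_ne_last n).symm, add_assoc, Matrix.single_add]

lemma corner_injective : Function.Injective (corner n R) := by
  intro a b h
  have := congrArg (fun M : U n R => M.1.1 0 (Fin.last n)) h
  simpa [corner] using this

lemma corner_mem_center (a : Multiplicative R) : corner n R a ∈ Subgroup.center (U n R) := by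
  refine Subgroup.mem_center_iff.2 fun M => Subtype.ext (Units.ext ?_)
  change M.1.1 * (1 + Matrix.single 0 (Fin.last n) a.toAdd) =
    (1 + Matrix.single 0 (Fin.last n) a.toAdd) * M.1.1
  rw [mul_add, add_mul, mul_one, one_mul, mul_single_corner]
  exact congrArg (M.1.1 + ·) (single_corner_mul n R M a.toAdd).symm

instance corner_range_normal : (corner n R).range.Normal where
  conj_mem := by
    rintro _ ⟨a, rfl⟩ M
    rw [(Subgroup.mem_center_iff.1 (corner_mem_center n R a) M), mul_inv_cancel_right]
    exact ⟨a, rfl⟩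

/-- `Ū_n(R) = 𝕌_n(R) / R⁺`. -/
def Ubar : Type _ := U n R ⧸ (corner n R).range

instance : Group (Ubar n R) := inferInstanceAs (Group (U n R ⧸ (corner n R).range))

/-- `Ū_n(R)` carries the discrete topology (it is a finite group when `R` is finite). -/
instance : TopologicalSpace (Ubar n R) := ⊥

instance : DiscreteTopology (Ubar n R) := ⟨rfl⟩

/-- The central extension `0 → R⁺ → 𝕌_n(R) → Ū_n(R) → 1`. -/
def centralExtension : GroupExtension (Multiplicative R) (U n R) (Ubar n R) where
  inl := corner n R
  rightHom := QuotientGroup.mk' (corner n R).range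
  inl_injective := corner_injective n R
  range_inl_eq_ker_rightHom := (QuotientGroup.ker_mk' _).symm
  rightHom_surjective := QuotientGroup.mk'_surjective _

variable {n R}

/-- The `(i, j)`-entry of an element of `Ū_n(R)`, for `(i, j)` not the upper right corner. -/
def Ubar.entry (i j : Fin (n + 1)) (hij : (i, j) ≠ (0, Fin.last n)) (M : Ubar n R) : R :=
  Quotient.liftOn' M (U.entry i j) (by
    intro M N h
    rw [QuotientGroup.leftRel_apply] at h
    obtain ⟨a, ha⟩ := h
    have hN : N = M * corner n R a := by rw [ha, mul_inv_cancel_left]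
    have : N.1.1 = M.1.1 + Matrix.single 0 (Fin.last n) a.toAdd := by
      rw [hN]
      change M.1.1 * (1 + Matrix.single 0 (Fin.last n) a.toAdd) = _
      rw [mul_add, mul_one, mul_single_corner]
    rw [U.entry, U.entry, this, Matrix.add_apply, Matrix.single_apply_of_ne, add_zero]
    rintro ⟨rfl, rfl⟩
    exact hij rfl)

end Unitriangular

/-! ## The class of a central extension -/

section Extension

variable {m : ℕ} {E Q : Type*} [Group E] [Group Q]

/-- The factor set of a section `s` of an extension of `Q` by `ℤ/m`: the element `c(g, h)` of
`ℤ/m` with `s(g) s(h) = c(g, h) s(gh)`. -/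
def factorSet (S : GroupExtension (Multiplicative (ZMod m)) E Q) (s : S.Section) (p : Q × Q) :
    ZMod m :=
  Multiplicative.toAdd (s.mul_mul_mul_inv_mem_range_inl p.1 p.2).choose

lemma inl_factorSet (S : GroupExtension (Multiplicative (ZMod m)) E Q) (s : S.Section)
    (g h : Q) : S.inl (Multiplicative.ofAdd (factorSet S s (g, h))) = s g * s h * (s (g * h))⁻¹ :=
  (s.mul_mul_mul_inv_mem_range_inl g h).choose_spec

/-- The factor set of a section of a central extension of a discrete group is a `2`-cocycle. -/
lemma factorSet_mem [TopologicalSpace Q] [DiscreteTopology Q]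
    (S : GroupExtension (Multiplicative (ZMod m)) E Q)
    (hS : ∀ a, S.inl a ∈ Subgroup.center E) (s : S.Section) : factorSet S s ∈ Z2 m Q := by
  refine ⟨continuous_of_discreteTopology, fun g h k => ?_⟩
  have key : ∀ x y, s x * s y =
      S.inl (Multiplicative.ofAdd (factorSet S s (x, y))) * s (x * y) := fun x y => by
    rw [inl_factorSet, inv_mul_cancel_right]
  have hc : ∀ (a : Multiplicative (ZMod m)) (e : E), e * S.inl a = S.inl a * e := fun a e =>
    Subgroup.mem_center_iff.1 (hS a) e
  apply Multiplicative.ofAdd.injective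
  apply S.inl_injective
  apply mul_right_cancel (b := s (g * h * k))
  rw [ofAdd_add, ofAdd_add, S.inl.map_mul, S.inl.map_mul, mul_assoc, ← key, ← mul_assoc, ← key,
    mul_assoc (s g), key h k, ← mul_assoc, hc, mul_assoc, key g (h * k), ← mul_assoc,
    ← mul_assoc g h k]

/-- The class in `H²(Q, ℤ/m)` corresponding to a central extension of the discrete group `Q` by
`ℤ/m` under the Schreier correspondence: the class of the factor set of a section. -/
def extensionClass [TopologicalSpace Q] [DiscreteTopology Q]
    (S : GroupExtension (Multiplicative (ZMod m)) E Q)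
    (hS : ∀ a, S.inl a ∈ Subgroup.center E) : H2 m Q :=
  H2.mk ⟨factorSet S S.surjInvRightHom, factorSet_mem S hS S.surjInvRightHom⟩

/-- The class `α ∈ H²(Ū_n(ℤ/m), ℤ/m)` of `0 → ℤ/m → 𝕌_n(ℤ/m) → Ū_n(ℤ/m) → 1`. -/
def alpha (n m : ℕ) [NeZero n] : H2 m (Ubar n (ZMod m)) :=
  extensionClass (centralExtension n (ZMod m)) (corner_mem_center n (ZMod m))

/-- The superdiagonal entries of `ρ : Γ → Ū₃(ℤ/m)` are `χ₁, χ₂, χ₃`. -/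
def HasSuperdiagonal {Γ : Type*} [Group Γ] [TopologicalSpace Γ]
    (ρ : Γ →ₜ* Ubar 3 (ZMod m)) (χ₁ χ₂ χ₃ : H1 m Γ) : Prop :=
  ∀ g : Γ, Ubar.entry 0 1 (by decide) (ρ g) = χ₁.1 g ∧
    Ubar.entry 1 2 (by decide) (ρ g) = χ₂.1 g ∧ Ubar.entry 2 3 (by decide) (ρ g) = χ₃.1 g

end Extension

end

end KummerMassey

namespace KummerMassey

noncomputable section

/-! ## Generalities on cohomology classes -/

section Basics

variable {m : ℕ} {Γ : Type*} [Group Γ] [TopologicalSpace Γ]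

/-! The homomorphism `ρ` supplies primitives of χ₁ ∪ χ₂ and χ₂ ∪ χ₃. The task is to change them by
elements of H¹ until the Massey cocycle χ₁ ∪ ψ + φ ∪ χ₃ becomes a coboundary; its primitive is then
the missing corner entry of a lift to 𝕌₃.

It suffices to find φ with φ|_M ∪ χ₃|_M = 0, where M = Ker χ₁. The Massey cocycle then dies on M, so
by exactness it is cohomologous to some η ∪ χ₁, and by anticommutativity of the cup product
replacing ψ by ψ + η cancels it.

Finding φ is a computation in A. Put N = Ker χ₃, L = M ∩ N, P = Ker(χ₁ - χ₃), and choose σ, τ dual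
to χ₁, χ₃. Since χ₂ ∪ χ₁ = χ₂ ∪ χ₃ = 0, χ₂ is the corestriction of κ_M(α) and of κ_N(y). The traces
of α and y in G agree modulo m A^G, and after changing α by an element of A^G they are equal. Hence
α - y has trace zero for the cyclic group P/L, which στ generates, and vanishing of Ĥ⁻¹ gives α - y
= (στ - 1)w with w ∈ A^L.

The cochain φ built from χ₂ = Cor κ_M(α) restricts on M to κ_M(a₀), where a₀ = ∑ i σ^i α
(`exists_primitive_of_sum_eq`). Both a₀ and v = N_{M/L}(w) are mapped by σ - 1 to mα - N_σ α, where
N_σ = ∑ σ^i, so x = a₀ - v is G-invariant (`exists_sum_nsmul_eq_add_trace`). Subtracting κ_G(x) from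
φ leaves Cor κ_L(w) on M, whose cup product with χ₃|_M vanishes because L = Ker χ₃|_M. -/

lemma H1.apply_mul (χ : H1 m Γ) (g h : Γ) : χ.1 (g * h) = χ.1 g + χ.1 h := χ.2.2 g h

lemma H1.apply_one (χ : H1 m Γ) : χ.1 1 = 0 := by
  have := χ.2.2 1 1
  rw [mul_one] at this
  exact left_eq_add.1 this

lemma H1.apply_inv (χ : H1 m Γ) (g : Γ) : χ.1 g⁻¹ = -χ.1 g := by
  have := χ.2.2 g⁻¹ g
  rw [inv_mul_cancel, H1.apply_one] at this
  exact eq_neg_of_add_eq_zero_left this.symm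

lemma H1.apply_pow (χ : H1 m Γ) (g : Γ) (n : ℕ) : χ.1 (g ^ n) = n * χ.1 g := by
  induction n with
  | zero => simp [H1.apply_one]
  | succ n ih => rw [pow_succ, H1.apply_mul, ih]; push_cast; ring

instance H1.normal_ker (χ : H1 m Γ) : (H1.ker χ).Normal :=
  MonoidHom.normal_ker _

lemma H2.mk_eq_mk_iff (f f' : Z2 m Γ) : H2.mk f = H2.mk f' ↔ f.1 - f'.1 ∈ B2 m Γ :=
  Submodule.Quotient.eq _

lemma H2.mk_eq_zero_iff (f : Z2 m Γ) : H2.mk f = 0 ↔ f.1 ∈ B2 m Γ :=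
  Submodule.Quotient.mk_eq_zero _

/-- Linearly independent classes in `H¹(Γ, ℤ/m)` are jointly surjective. -/
lemma exists_apply_eq_of_linearIndependent [NeZero m] (χ₁ χ₂ : H1 m Γ)
    (h : LinearIndependent (ZMod m) ![χ₁, χ₂]) (a b : ZMod m) :
    ∃ g, χ₁.1 g = a ∧ χ₂.1 g = b := by
  let S : AddSubgroup (ZMod m × ZMod m) :=
    { carrier := Set.range fun g => (χ₁.1 g, χ₂.1 g)
      add_mem' := by
        rintro _ _ ⟨g, rfl⟩ ⟨k, rfl⟩
        exact ⟨g * k, by simp [H1.apply_mul]⟩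
      zero_mem' := ⟨1, by simp [H1.apply_one]⟩
      neg_mem' := by
        rintro _ ⟨g, rfl⟩
        exact ⟨g⁻¹, by simp [H1.apply_inv]⟩ }
  suffices hS : (a, b) ∈ S by
    obtain ⟨g, hg⟩ := hS
    exact ⟨g, congrArg Prod.fst hg, congrArg Prod.snd hg⟩
  by_contra hab
  have hne : (QuotientAddGroup.mk (a, b) : (ZMod m × ZMod m) ⧸ S) ≠ 0 := by
    rwa [Ne, QuotientAddGroup.eq_zero_iff]
  -- As m need not be prime, dimension counting is replaced by duality: a character separates (a, b)
  -- from the image S. Its values are m-torsion, so it is a linear form with coefficients k₁, k₂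
  -- modulo m; vanishing on S makes it a relation between χ₁ and χ₂.
  obtain ⟨c, hc⟩ := CharacterModule.exists_character_apply_ne_zero_of_ne_zero hne
  let f : ZMod m × ZMod m →+ AddCircle (1 : ℚ) := c.comp (QuotientAddGroup.mk' S)
  have hm : 0 < m := NeZero.pos m
  have hm0 : (m : ℚ) ≠ 0 := by exact_mod_cast hm.ne'
  have htors : ∀ v, ∃ k : ℕ, ((k / m * 1 : ℚ) : AddCircle (1 : ℚ)) = f v := by
    intro v
    have : m • f v = 0 := by
      rw [← map_nsmul]
      have : m • v = 0 := by ext <;> simp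
      rw [this, map_zero]
    obtain ⟨k, -, hk⟩ := (AddCircle.nsmul_eq_zero_iff (p := (1 : ℚ)) hm).1 this
    exact ⟨k, hk⟩
  obtain ⟨k₁, hk₁⟩ := htors (1, 0)
  obtain ⟨k₂, hk₂⟩ := htors (0, 1)
  have hf : ∀ x y : ZMod m, f (x, y) =
      (((x.val * k₁ + y.val * k₂ : ℕ) / m : ℚ) : AddCircle (1 : ℚ)) := by
    intro x y
    have hxy : (x, y) = x.val • ((1 : ZMod m), (0 : ZMod m)) + y.val • ((0 : ZMod m), 1) := by
      ext <;> simp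
    rw [hxy, map_add, map_nsmul, map_nsmul, ← hk₁, ← hk₂, ← AddCircle.coe_nsmul,
      ← AddCircle.coe_nsmul, ← AddCircle.coe_add]
    congr 1
    push_cast
    simp only [nsmul_eq_mul]
    ring
  have hz : ∀ x y : ZMod m, f (x, y) = 0 ↔ (k₁ : ZMod m) * x + k₂ * y = 0 := by
    intro x y
    have hcast : (k₁ : ZMod m) * x + k₂ * y = ((x.val * k₁ + y.val * k₂ : ℕ) : ZMod m) := by
      push_cast
      rw [ZMod.natCast_zmod_val, ZMod.natCast_zmod_val]
      ring
    rw [hf, hcast, ZMod.natCast_eq_zero_iff, AddCircle.coe_eq_zero_iff]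
    constructor
    · rintro ⟨n, hn⟩
      rw [zsmul_eq_mul, mul_one, eq_div_iff hm0] at hn
      have : (n * m : ℤ) = ((x.val * k₁ + y.val * k₂ : ℕ) : ℤ) := by exact_mod_cast hn
      exact Int.natCast_dvd_natCast.1 ⟨n, by rw [← this, mul_comm]⟩
    · rintro ⟨n, hn⟩
      refine ⟨n, ?_⟩
      rw [hn]
      push_cast
      field_simp
      simp
  have hrel : (k₁ : ZMod m) • χ₁ + (k₂ : ZMod m) • χ₂ = 0 := by
    refine Subtype.ext (funext fun g => ?_)
    change (k₁ : ZMod m) * χ₁.1 g + k₂ * χ₂.1 g = 0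
    rw [← hz]
    have : (QuotientAddGroup.mk (χ₁.1 g, χ₂.1 g) : (ZMod m × ZMod m) ⧸ S) = 0 :=
      (QuotientAddGroup.eq_zero_iff _).2 ⟨g, rfl⟩
    change c (QuotientAddGroup.mk (χ₁.1 g, χ₂.1 g)) = 0
    rw [this, map_zero]
  obtain ⟨h₁, h₂⟩ := LinearIndependent.pair_iff.1 h _ _ hrel
  refine hc ((hz a b).2 ?_)
  rw [h₁, h₂]
  ring

end Basics

/-! ## Cosets of the kernel of a character -/

section Cosets

variable {m : ℕ} [NeZero m] {G : Type*} [Group G] [TopologicalSpace G]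

lemma sum_zmod_val {B : Type*} [AddCommMonoid B] (f : ℕ → B) :
    ∑ i : ZMod m, f i.val = ∑ i ∈ Finset.range m, f i := by
  obtain ⟨n, rfl⟩ := Nat.exists_eq_succ_of_ne_zero (NeZero.ne m)
  exact Fin.sum_univ_eq_sum_range f (n + 1)

/-- If `M` is the kernel of `χ` on `M'` and `χ σ = 1`, the powers of `σ` represent `M'/M`. -/
lemma bijective_pow_coset (χ : H1 m G) {M M' : Subgroup G} {σ : G} (hσ : σ ∈ M')
    (hχ : χ.1 σ = 1) (hM : ∀ g ∈ M', g ∈ M ↔ χ.1 g = 0) :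
    Function.Bijective fun i : ZMod m =>
      (QuotientGroup.mk (⟨σ ^ i.val, pow_mem hσ _⟩ : M') : M' ⧸ M.subgroupOf M') := by
  have key : ∀ g h : M', (QuotientGroup.mk g : M' ⧸ M.subgroupOf M') = QuotientGroup.mk h ↔
      χ.1 g = χ.1 h := by
    intro g h
    rw [QuotientGroup.eq, Subgroup.mem_subgroupOf, hM _ (g⁻¹ * h).2]
    simp only [Subgroup.coe_mul, Subgroup.coe_inv, H1.apply_mul, H1.apply_inv]
    rw [neg_add_eq_zero]
  constructor
  · intro i j hij
    have := (key _ _).1 hij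
    simpa [H1.apply_pow, hχ] using this
  · intro q
    induction q using QuotientGroup.induction_on with
    | H g => exact ⟨χ.1 g, (key _ _).2 (by simp [H1.apply_pow, hχ])⟩

end Cosets

/-! ## Corestriction -/

section Corestriction

variable {m : ℕ}

/-- The transfer may be computed with any transversal; π records how g permutes the cosets of the
chosen one. -/
lemma cor_apply {Γ : Type*} [Group Γ] [TopologicalSpace Γ] [IsTopologicalGroup Γ]
    (H : Subgroup Γ) (hH : IsOpen (H : Set Γ)) [H.FiniteIndex] (ω : H1 m H)
    {ι : Type*} [Fintype ι] (s : ι → Γ)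
    (hs : Function.Bijective fun i => (QuotientGroup.mk (s i) : Γ ⧸ H))
    (g : Γ) (π : ι ≃ ι) (hπ : ∀ i, (s (π i))⁻¹ * g * s i ∈ H) :
    (cor H hH ω).1 g = ∑ i, ω.1 ⟨(s (π i))⁻¹ * g * s i, hπ i⟩ := by
  let e : ι ≃ Γ ⧸ H := Equiv.ofBijective _ hs
  let r : Γ ⧸ H → Γ := fun q => s (e.symm q)
  have hr : ∀ q, (r q : Γ ⧸ H) = q := fun q => e.apply_symm_apply q
  let T : H.LeftTransversal := ⟨Set.range r, Subgroup.isComplement_range_left hr⟩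
  have hT : ∀ q, (T.2.leftQuotientEquiv q : Γ) = r q := fun q =>
    Subgroup.IsComplement.leftQuotientEquiv_apply hr q
  change Multiplicative.toAdd (MonoidHom.transfer (H1.toHom ω) g) = _
  rw [MonoidHom.transfer_def _ T]
  apply Multiplicative.ofAdd.injective
  rw [ofAdd_toAdd, ofAdd_sum]
  let _ := H.fintypeQuotientOfFiniteIndex
  refine (Fintype.prod_equiv (π.trans e) _ _ fun i => ?_).symm
  refine congrArg (fun x => Multiplicative.ofAdd (ω.1 x)) (Subtype.ext ?_)
  have h1 : r ((π.trans e) i) = s (π i) := by simp [r]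
  have h2 : g⁻¹ • (π.trans e) i = e i := by
    change g⁻¹ • (QuotientGroup.mk (s (π i)) : Γ ⧸ H) = QuotientGroup.mk (s i)
    refine QuotientGroup.eq.2 ?_
    have := hπ i
    simpa [mul_assoc] using this
  have h3 : r (e i) = s i := by simp [r]
  change _ = (T.2.leftQuotientEquiv _ : Γ)⁻¹ * ((g • T).2.leftQuotientEquiv _ : Γ)
  rw [Subgroup.smul_apply_eq_smul_apply_inv_smul, h2, hT, hT, h1, h3, smul_eq_mul]
  exact mul_assoc _ _ _

variable {G : Type*} [Group G] [TopologicalSpace G]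

lemma surjective_map_ofSubgroupOf {H K : Subgroup G} (h : H ≤ K) :
    Function.Surjective (H1.map (m := m) (ofSubgroupOf h)) := by
  intro ω
  refine ⟨⟨fun x => ω.1 ⟨⟨x.1, h x.2⟩, x.2⟩,
    ω.2.1.comp ((continuous_subtype_val.subtype_mk _).subtype_mk _),
    fun x y => ω.2.2 ⟨⟨x.1, h x.2⟩, x.2⟩ ⟨⟨y.1, h y.2⟩, y.2⟩⟩, rfl⟩

variable [IsTopologicalGroup G] [CompactSpace G]

/-- Openness and finite index are data attached to the subgroup, so an equality of subgroups must be
substituted rather than rewritten. -/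
lemma cor_congr_range {Γ : Type*} [Group Γ] [TopologicalSpace Γ] [IsTopologicalGroup Γ]
    {H H' : Subgroup Γ} (h : H = H') (hH : IsOpen (H : Set Γ)) (hH' : IsOpen (H' : Set Γ))
    [H.FiniteIndex] [H'.FiniteIndex] :
    Set.range (cor (m := m) H hH) = Set.range (cor (m := m) H' hH') := by
  subst h
  rfl

/-- Corestriction from `M` and corestriction from the kernel of a class with kernel `M` have the
same range. -/
lemma range_corLE [NeZero m] {M M' : OpenNormalSubgroup G} (h : M.toSubgroup ≤ M'.toSubgroup)
    (χ : H1 m M'.toSubgroup) (hχ : M.toSubgroup.subgroupOf M'.toSubgroup = H1.ker χ) :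
    Set.range (corLE (m := m) h) = Set.range (cor (H1.ker χ) (H1.isOpen_ker χ)) := by
  rw [← cor_congr_range hχ (M.isOpen'.preimage continuous_subtype_val)]
  exact (surjective_map_ofSubgroupOf h).range_comp
    (cor (m := m) (M.toSubgroup.subgroupOf M'.toSubgroup)
      (M.isOpen'.preimage continuous_subtype_val))

end Corestriction

/-! ## Traces along cyclic quotients -/

section Trace

variable {m : ℕ} {G : Type*} [Group G]
  {A : Type*} [AddCommGroup A] [DistribMulAction G A]

lemma smul_eq_of_mem_fixed {M : Subgroup G} {a : A} (ha : a ∈ fixed A M) {g : G} (hg : g ∈ M) :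
    g • a = a := ha ⟨g, hg⟩

lemma smul_eq_smul_of_mem_fixed {M : Subgroup G} {a : A} (ha : a ∈ fixed A M) {g h : G}
    (hgh : h⁻¹ * g ∈ M) : g • a = h • a := by
  rw [← inv_smul_eq_iff, smul_smul, smul_eq_of_mem_fixed ha hgh]

/-- Multiplication by γ shifts the sum by one index, and the term that leaves equals the one that
enters. -/
lemma smul_sum_pow_smul {γ : G} {w : A} (hw : γ ^ m • w = w) :
    γ • ∑ i ∈ Finset.range m, γ ^ i • w = ∑ i ∈ Finset.range m, γ ^ i • w := by
  rw [Finset.smul_sum]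
  have := Finset.sum_range_succ' (fun i => γ ^ i • w) m
  rw [Finset.sum_range_succ, hw, pow_zero, one_smul] at this
  rw [add_right_cancel this]
  refine Finset.sum_congr rfl fun i _ => ?_
  rw [smul_smul, pow_succ']

/-- The weighted sum `∑ i σ^i a` is a primitive of `m a - N_σ a` for `σ - 1`. -/
lemma smul_sum_nsmul_pow_smul {σ : G} {a : A} (ha : σ ^ m • a = a) :
    σ • (∑ i ∈ Finset.range m, i • σ ^ i • a) - ∑ i ∈ Finset.range m, i • σ ^ i • a =
      m • a - ∑ i ∈ Finset.range m, σ ^ i • a := by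
  -- Abel summation for every length n; periodicity of a is needed only at n = m, to simplify the
  -- boundary term.
  have key : ∀ n : ℕ, σ • (∑ i ∈ Finset.range n, i • σ ^ i • a) -
      ∑ i ∈ Finset.range n, i • σ ^ i • a =
      n • σ ^ n • a - ∑ i ∈ Finset.range n, σ ^ (i + 1) • a := by
    intro n
    induction n with
    | zero => simp
    | succ n ih =>
      rw [Finset.sum_range_succ, smul_add, Finset.sum_range_succ (fun i => σ ^ (i + 1) • a),
        smul_comm σ n, smul_smul σ, ← pow_succ', add_smul, one_smul]
      rw [sub_eq_iff_eq_add] at ih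
      rw [ih]
      abel
  rw [key, ha, ← smul_sum_pow_smul ha, Finset.smul_sum]
  simp only [smul_smul, pow_succ']

variable [NeZero m] [TopologicalSpace G]

lemma trace_coe (χ : H1 m G) {M M' : Subgroup G} [(M.subgroupOf M').FiniteIndex] {σ : G}
    (hσ : σ ∈ M') (hχ : χ.1 σ = 1) (hM : ∀ g ∈ M', g ∈ M ↔ χ.1 g = 0) (a : fixed A M) :
    (trace M M' a : A) = ∑ i ∈ Finset.range m, σ ^ i • (a : A) := by
  have hb := bijective_pow_coset χ hσ hχ hM
  rw [← sum_zmod_val (m := m) fun i => σ ^ i • (a : A)]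
  change ∑ᶠ q : M' ⧸ M.subgroupOf M', cosetSmul a q = _
  rw [← finsum_comp_equiv (Equiv.ofBijective _ hb), finsum_eq_sum_of_fintype]
  rfl

/-- Vanishing of `Ĥ⁻¹` in a cyclic situation: elements of trace zero are of the form
`γ w - w`. -/
lemma exists_smul_sub_eq_of_subsingleton (χ : H1 m G) {M M' : Subgroup G} [M.Normal]
    [(M.subgroupOf M').FiniteIndex] {γ : G}
    (hγ : γ ∈ M') (hχ : χ.1 γ = 1) (hM : ∀ g ∈ M', g ∈ M ↔ χ.1 g = 0)
    (hT : Subsingleton (TateHNegOne A M M')) (a : fixed A M)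
    (ha : ∑ i ∈ Finset.range m, γ ^ i • (a : A) = 0) :
    ∃ w ∈ fixed A M, (a : A) = γ • w - w := by
  have hker : a ∈ (trace M M').ker := by
    rw [AddMonoidHom.mem_ker]
    refine Subtype.ext ?_
    rw [trace_coe χ hγ hχ hM, ha]
    rfl
  have haug : a ∈ augmentation (A := A) M M' := by
    have h0 : (QuotientAddGroup.mk (⟨a, hker⟩ : (trace (A := A) M M').ker) :
        TateHNegOne A M M') = 0 := Subsingleton.elim _ _
    rwa [QuotientAddGroup.eq_zero_iff, AddSubgroup.mem_addSubgroupOf] at h0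
  -- Every ρ ∈ M' acts on A^M as a power of γ, and γ^n - 1 is a multiple of γ - 1, so the generators
  -- of the augmentation subgroup all have the required form.
  have hpow : ∀ (n : ℕ) (x : A), x ∈ fixed A M → ∃ w ∈ fixed A M, γ ^ n • x - x = γ • w - w := by
    intro n x hx
    induction n with
    | zero => exact ⟨0, zero_mem _, by simp⟩
    | succ n ih =>
      obtain ⟨w, hw, h⟩ := ih
      refine ⟨γ ^ n • x + w, add_mem (smul_mem_fixed _ hx) hw, ?_⟩
      rw [pow_succ', mul_smul, smul_add, add_sub_add_comm, ← h]
      abel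
  refine AddSubgroup.closure_induction (p := fun (a : fixed A M) _ => ∃ w ∈ fixed A M, (a : A) = γ • w - w)
    ?_ ?_ ?_ ?_ haug
  · rintro _ ⟨ρ, hρ, x, rfl⟩
    obtain ⟨w, hw, h⟩ := hpow (χ.1 ρ).val x x.2
    refine ⟨w, hw, ?_⟩
    rw [← h]
    change ρ • (x : A) - x = _
    rw [smul_eq_smul_of_mem_fixed x.2 (h := γ ^ (χ.1 ρ).val)]
    rw [hM _ (mul_mem (inv_mem (pow_mem hγ _)) hρ)]
    simp [H1.apply_mul, H1.apply_inv, H1.apply_pow, hχ]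
  · exact ⟨0, zero_mem _, by simp⟩
  · rintro x y - - ⟨w, hw, h⟩ ⟨w', hw', h'⟩
    refine ⟨w + w', add_mem hw hw', ?_⟩
    change (x : A) + y = _
    rw [h, h', smul_add]
    abel
  · rintro x - ⟨w, hw, h⟩
    refine ⟨-w, neg_mem hw, ?_⟩
    change -(x : A) = _
    rw [h, smul_neg]
    abel

/-- The quotient of `M'` by the kernel `M` of a character is cyclic of order `m`. -/
lemma isCyclic_and_card_of_apply_eq_one (χ : H1 m G) {M M' : Subgroup G} [M.Normal] {σ : G}
    (hσ : σ ∈ M') (hχ : χ.1 σ = 1) (hM : ∀ g ∈ M', g ∈ M ↔ χ.1 g = 0) :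
    IsCyclic (M' ⧸ M.subgroupOf M') ∧ Nat.card (M' ⧸ M.subgroupOf M') = m := by
  have hb := bijective_pow_coset χ hσ hχ hM
  refine ⟨⟨QuotientGroup.mk ⟨σ, hσ⟩, fun q => ?_⟩, ?_⟩
  · obtain ⟨i, rfl⟩ := hb.2 q
    exact ⟨i.val, by simp only [zpow_natCast]; rfl⟩
  · rw [← Nat.card_congr (Equiv.ofBijective _ hb), Nat.card_zmod]

/-- If `σ, τ` are dual to the characters `χ₁, χ₃`, and `α`, `y` are fixed by the kernels of `χ₁`,
`χ₃` and have the same trace in `G`, then the weighted sum `∑ i σ^i α` is the sum of a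
`G`-invariant element and a trace. -/
lemma exists_sum_nsmul_eq_add_trace (χ₁ χ₃ : H1 m G) {L P : Subgroup G} [L.Normal]
    [(L.subgroupOf P).FiniteIndex]
    (hL : ∀ g, g ∈ L ↔ χ₁.1 g = 0 ∧ χ₃.1 g = 0) (hP : ∀ g, g ∈ P ↔ χ₁.1 g = χ₃.1 g)
    (hT : Subsingleton (TateHNegOne A L P)) {σ τ : G} (hσ₁ : χ₁.1 σ = 1) (hσ₃ : χ₃.1 σ = 0)
    (hτ₁ : χ₁.1 τ = 0) (hτ₃ : χ₃.1 τ = 1) {α y : A} (hα : α ∈ fixed A (H1.ker χ₁))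
    (hy : y ∈ fixed A (H1.ker χ₃))
    (h : ∑ i ∈ Finset.range m, σ ^ i • α = ∑ i ∈ Finset.range m, τ ^ i • y) :
    ∃ x ∈ fixed A (⊤ : Subgroup G), ∃ w ∈ fixed A L,
      ∑ i ∈ Finset.range m, i • σ ^ i • α = x + ∑ i ∈ Finset.range m, τ ^ i • w := by
  have hL₁ : L ≤ H1.ker χ₁ := fun g hg => (H1.mem_ker _ _).2 ((hL g).1 hg).1
  have hL₃ : L ≤ H1.ker χ₃ := fun g hg => (H1.mem_ker _ _).2 ((hL g).1 hg).2
  have hfix₁ : ∀ g k : G, χ₁.1 g = χ₁.1 k → g • α = k • α := fun g k hgk =>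
    smul_eq_smul_of_mem_fixed hα
      ((H1.mem_ker _ _).2 (by rw [H1.apply_mul, H1.apply_inv, hgk, neg_add_cancel]))
  have hfix₃ : ∀ g k : G, χ₃.1 g = χ₃.1 k → g • y = k • y := fun g k hgk =>
    smul_eq_smul_of_mem_fixed hy
      ((H1.mem_ker _ _).2 (by rw [H1.apply_mul, H1.apply_inv, hgk, neg_add_cancel]))
  have hγ₁ : χ₁.1 (σ * τ) = 1 := by rw [H1.apply_mul, hσ₁, hτ₁, add_zero]
  have hγ₃ : χ₃.1 (σ * τ) = 1 := by rw [H1.apply_mul, hσ₃, hτ₃, zero_add]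
  -- The element στ acts on α as σ and on y as τ, so hypothesis `h` says exactly that α - y has
  -- trace zero for P/L.
  obtain ⟨w, hw, hwe⟩ := exists_smul_sub_eq_of_subsingleton χ₁ ((hP _).2 (hγ₁.trans hγ₃.symm))
    hγ₁ (fun g hg => by rw [hL, ← (hP g).1 hg, and_self]) hT
    ⟨α - y, sub_mem (fixed_anti hL₁ hα) (fixed_anti hL₃ hy)⟩ (by
      simp only [smul_sub, Finset.sum_sub_distrib]
      rw [sub_eq_zero]
      refine Eq.trans ?_ (h.trans ?_)
      · refine Finset.sum_congr rfl fun i _ => hfix₁ _ _ ?_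
        rw [H1.apply_pow, H1.apply_pow, hγ₁, hσ₁]
      · refine Finset.sum_congr rfl fun i _ => hfix₃ _ _ ?_
        rw [H1.apply_pow, H1.apply_pow, hγ₃, hτ₃])
  change α - y = _ at hwe
  -- G/L is abelian, since it embeds in (ℤ/m)² through (χ₁, χ₃).
  have hcomm : ∀ g k : G, g • k • w = k • g • w := by
    intro g k
    rw [smul_smul, smul_smul]
    refine smul_eq_smul_of_mem_fixed hw ((hL _).2 ?_)
    simp only [H1.apply_mul, H1.apply_inv]
    constructor <;> ring
  set b := ∑ i ∈ Finset.range m, σ ^ i • α with hb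
  set v := ∑ i ∈ Finset.range m, τ ^ i • w with hv
  set a₀ := ∑ i ∈ Finset.range m, i • σ ^ i • α with ha₀
  have hv_smul : ∀ g : G, g • v = ∑ i ∈ Finset.range m, τ ^ i • g • w := by
    intro g
    rw [hv, Finset.smul_sum]
    exact Finset.sum_congr rfl fun i _ => hcomm _ _
  have hτv : τ • v = v := smul_sum_pow_smul (smul_eq_of_mem_fixed hw
    ((hL _).2 (by simp [H1.apply_pow, hτ₁])))
  have hα_fix : ∀ g, χ₁.1 g = 0 → g • α = α := fun g hg =>
    smul_eq_of_mem_fixed hα ((H1.mem_ker _ _).2 hg)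
  -- As τ fixes v, (σ - 1)v = (στ - 1)v = N_τ(α - y), with N_τ = ∑ τ^i. Here N_τ α = mα because τ
  -- fixes α, and N_τ y = b by `h`.
  have h1 : σ • v - v = m • α - b := by
    have h2 : (σ * τ) • v - v = ∑ i ∈ Finset.range m, τ ^ i • (α - y) := by
      rw [hv_smul, hv, ← Finset.sum_sub_distrib]
      refine Finset.sum_congr rfl fun i _ => ?_
      rw [hwe, smul_sub]
    rw [mul_smul, hτv] at h2
    rw [h2]
    simp only [smul_sub, Finset.sum_sub_distrib]
    rw [← h]
    congr 1
    rw [Finset.sum_congr rfl fun i _ => hα_fix (τ ^ i) (by simp [H1.apply_pow, hτ₁])]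
    simp
  have h3 : σ • a₀ - a₀ = m • α - b :=
    smul_sum_nsmul_pow_smul (hα_fix _ (by simp [H1.apply_pow]))
  have hM : ∀ g, χ₁.1 g = 0 → g • (a₀ - v) = a₀ - v := by
    intro g hg
    rw [smul_sub]
    congr 1
    · rw [ha₀, Finset.smul_sum]
      refine Finset.sum_congr rfl fun i _ => ?_
      rw [smul_comm, smul_smul, hfix₁ (g * σ ^ i) (σ ^ i) (by rw [H1.apply_mul, hg, zero_add])]
    -- Modulo L, an element of Ker χ₁ is a power of τ, and τ fixes v.
    · have : g • v = τ ^ (χ₃.1 g).val • v := by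
        rw [hv_smul, hv_smul]
        refine Finset.sum_congr rfl fun i _ => congrArg _ ?_
        refine smul_eq_smul_of_mem_fixed hw ((hL _).2 ?_)
        simp [H1.apply_mul, H1.apply_inv, H1.apply_pow, hg, hτ₁, hτ₃]
      rw [this]
      generalize (χ₃.1 g).val = n
      induction n with
      | zero => simp
      | succ n ih => rw [pow_succ, mul_smul, hτv, ih]
  have hσx : σ • (a₀ - v) = a₀ - v := by
    rw [smul_sub, ← sub_eq_zero, sub_sub_sub_comm, h3, h1, sub_self]
  refine ⟨a₀ - v, ?_, w, hw, (sub_add_cancel _ _).symm⟩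
  rintro ⟨g, -⟩
  change g • (a₀ - v) = a₀ - v
  -- G is generated by σ and Ker χ₁, both of which fix a₀ - v.
  have hg : g = σ ^ (χ₁.1 g).val * ((σ ^ (χ₁.1 g).val)⁻¹ * g) := by group
  rw [hg, mul_smul, hM _ (by simp [H1.apply_mul, H1.apply_inv, H1.apply_pow, hσ₁])]
  generalize (χ₁.1 g).val = n
  induction n with
  | zero => simp
  | succ n ih => rw [pow_succ, mul_smul, hσx, ih]

end Trace

/-! ## Homomorphisms to `Ū₃(ℤ/m)` and cochains -/

section Unipotent

variable {m : ℕ} {G : Type*} [Group G] [TopologicalSpace G]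

lemma Ubar.entry_zero_two_mul {R : Type*} [CommRing R] (M N : Ubar 3 R) :
    Ubar.entry 0 2 (by decide) (M * N) = Ubar.entry 0 2 (by decide) M +
      Ubar.entry 0 2 (by decide) N + Ubar.entry 0 1 (by decide) M * Ubar.entry 1 2 (by decide) N := by
  induction M using QuotientGroup.induction_on with
  | H M =>
  induction N using QuotientGroup.induction_on with
  | H N =>
  change (M.1.1 * N.1.1) 0 2 = M.1.1 0 2 + N.1.1 0 2 + M.1.1 0 1 * N.1.1 1 2
  rw [Matrix.mul_apply, Fin.sum_univ_four, M.2.1, N.2.1, N.2.2 3 2 (by decide)]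
  ring

lemma Ubar.entry_one_three_mul {R : Type*} [CommRing R] (M N : Ubar 3 R) :
    Ubar.entry 1 3 (by decide) (M * N) = Ubar.entry 1 3 (by decide) M +
      Ubar.entry 1 3 (by decide) N + Ubar.entry 1 2 (by decide) M * Ubar.entry 2 3 (by decide) N := by
  induction M using QuotientGroup.induction_on with
  | H M =>
  induction N using QuotientGroup.induction_on with
  | H N =>
  change (M.1.1 * N.1.1) 1 3 = M.1.1 1 3 + N.1.1 1 3 + M.1.1 1 2 * N.1.1 2 3
  rw [Matrix.mul_apply, Fin.sum_univ_four, M.2.1, N.2.1, M.2.2 1 0 (by decide)]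
  ring

/-- The pullback of the class of a central extension along a homomorphism that lifts to the
extension is zero. -/
lemma map_extensionClass_eq_zero {E Q : Type*} [Group E] [Group Q] [TopologicalSpace Q]
    [DiscreteTopology Q] (S : GroupExtension (Multiplicative (ZMod m)) E Q)
    (hS : ∀ a, S.inl a ∈ Subgroup.center E) (ρ : G →ₜ* Q) (r : G →* E)
    (hr : ∀ g, S.rightHom (r g) = ρ g)
    (hcont : @Continuous G E _ ⊥ r) : H2.map ρ (extensionClass S hS) = 0 := by
  let s := S.surjInvRightHom
  -- The section along ρ and the lift r differ by a central cochain v, whose coboundary is the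
  -- pulled-back factor set.
  have hex : ∀ g, ∃ a, S.inl a = s (ρ g) * (r g)⁻¹ := by
    intro g
    have : s (ρ g) * (r g)⁻¹ ∈ S.inl.range := by
      rw [S.range_inl_eq_ker_rightHom, MonoidHom.mem_ker, map_mul, map_inv, hr,
        s.rightHom_section]
      exact mul_inv_cancel _
    exact this
  choose v hv using hex
  have hvc : Continuous fun g => Multiplicative.toAdd (v g) := by
    refine continuous_def.2 fun V _ => ?_
    refine isOpen_iff_mem_nhds.2 fun g hg => ?_
    let _ : TopologicalSpace E := ⊥
    have _ : DiscreteTopology E := ⟨rfl⟩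
    have h1 : r ⁻¹' {r g} ∈ nhds g :=
      ((isOpen_discrete _).preimage hcont).mem_nhds rfl
    filter_upwards [h1] with k hk
    have hk : r k = r g := hk
    have : v k = v g := by
      apply S.inl_injective
      rw [hv, hv, ← hr, ← hr, hk]
    rw [Set.mem_preimage, this]
    exact hg
  change H2.mk (Z2.map ρ _) = 0
  rw [H2.mk_eq_zero_iff]
  refine ⟨_, hvc, fun g h => ?_⟩
  change factorSet S s (ρ g, ρ h) = _
  apply Multiplicative.ofAdd.injective
  apply S.inl_injective
  have hs : ∀ g, s (ρ g) = S.inl (v g) * r g := fun g => by rw [hv, inv_mul_cancel_right]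
  rw [inl_factorSet, ← map_mul ρ, hs, hs, hs, map_mul r, ofAdd_add, ofAdd_sub, map_mul, map_div]
  simp only [ofAdd_toAdd]
  have hc : ∀ (e : E) (a : Multiplicative (ZMod m)), e * S.inl a = S.inl a * e := fun e a =>
    Subgroup.mem_center_iff.1 (hS a) e
  rw [mul_inv_eq_iff_eq_mul, mul_assoc, ← mul_assoc (r g), hc, div_eq_mul_inv]
  have hc' := hc (S.inl (v (g * h)))⁻¹ (v g)
  simp only [mul_assoc]
  rw [← mul_assoc (S.inl (v g)), ← hc]
  simp only [mul_assoc]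
  rw [← mul_assoc _ (S.inl (v g)) (S.inl (v (g * h)) * _), hc']
  simp only [mul_assoc]
  rw [inv_mul_cancel_left]

/-- A defining system for the triple product of `χ₁, χ₂, χ₃` whose associated `2`-cocycle is a
coboundary yields a homomorphism to `Ū₃(ℤ/m)` that kills `α`. -/
lemma exists_hasSuperdiagonal_map_alpha_eq_zero (χ₁ χ₂ χ₃ : H1 m G)
    (φ ψ u : G → ZMod m) (hφc : Continuous φ) (hψc : Continuous ψ) (huc : Continuous u)
    (hφ : ∀ g h, φ (g * h) = φ g + φ h + χ₁.1 g * χ₂.1 h)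
    (hψ : ∀ g h, ψ (g * h) = ψ g + ψ h + χ₂.1 g * χ₃.1 h)
    (hu : ∀ g h, u (g * h) = u g + u h + (χ₁.1 g * ψ h + φ g * χ₃.1 h)) :
    ∃ ρ : G →ₜ* Ubar 3 (ZMod m), HasSuperdiagonal ρ χ₁ χ₂ χ₃ ∧
      H2.map ρ (alpha 3 m) = 0 := by
  have one_val : ∀ f : G → ZMod m, f (1 * 1) = f 1 + f 1 → f 1 = 0 := fun f h => by
    rw [mul_one] at h
    exact left_eq_add.1 h
  have hφ1 : φ 1 = 0 := one_val φ (by rw [hφ, H1.apply_one, zero_mul, add_zero])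
  have hψ1 : ψ 1 = 0 := one_val ψ (by rw [hψ, H1.apply_one, zero_mul, add_zero])
  have hu1 : u 1 = 0 := one_val u (by
    rw [hu, H1.apply_one, H1.apply_one, zero_mul, mul_zero, add_zero, add_zero])
  -- The coordinates are the entries (1,2), (2,3), (3,4), (1,3), (2,4), (1,4), in that order. The
  -- cochain identities are multiplicativity of this matrix, and continuity follows because it
  -- factors through a discrete space.
  let F : ZMod m × ZMod m × ZMod m × ZMod m × ZMod m × ZMod m → Matrix (Fin 4) (Fin 4) (ZMod m) :=
    fun t => !![1, t.1, t.2.2.2.1, t.2.2.2.2.2; 0, 1, t.2.1, t.2.2.2.2.1; 0, 0, 1, t.2.2.1;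
      0, 0, 0, 1]
  let T : G → ZMod m × ZMod m × ZMod m × ZMod m × ZMod m × ZMod m :=
    fun g => (χ₁.1 g, χ₂.1 g, χ₃.1 g, φ g, ψ g, u g)
  have hTc : Continuous T := χ₁.2.1.prodMk (χ₂.2.1.prodMk (χ₃.2.1.prodMk
    (hφc.prodMk (hψc.prodMk huc))))
  let r₀ : G →* Matrix (Fin 4) (Fin 4) (ZMod m) :=
    { toFun := fun g => F (T g)
      map_one' := by
        ext i j
        fin_cases i <;> fin_cases j <;> simp [F, T, H1.apply_one, hφ1, hψ1, hu1]
      map_mul' := fun g h => by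
        ext i j
        fin_cases i <;> fin_cases j <;>
          simp [F, T, Matrix.mul_apply, Fin.sum_univ_four, H1.apply_mul, hφ, hψ, hu] <;> ring }
  let r : G →* U 3 (ZMod m) := r₀.toHomUnits.codRestrict (U 3 (ZMod m)) fun g => by
    refine ⟨fun i => ?_, fun i j hij => ?_⟩
    · change F (T g) i i = 1
      fin_cases i <;> rfl
    · change F (T g) i j = 0
      fin_cases i <;> fin_cases j <;> first | rfl | exact absurd hij (by decide)
  have hrT : ∀ g h, T g = T h → r g = r h := fun g h hgh =>
    Subtype.ext (Units.ext (congrArg F hgh))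
  have hopen : ∀ g, {h | r h = r g} ∈ nhds g := fun g => by
    filter_upwards [((isOpen_discrete {T g}).preimage hTc).mem_nhds rfl] with h hh
    exact hrT _ _ hh
  have hrc : @Continuous G (U 3 (ZMod m)) _ ⊥ r := by
    let _ : TopologicalSpace (U 3 (ZMod m)) := ⊥
    have _ : DiscreteTopology (U 3 (ZMod m)) := ⟨rfl⟩
    refine continuous_iff_continuousAt.2 fun g => ?_
    rw [ContinuousAt, nhds_discrete (U 3 (ZMod m)), Filter.tendsto_pure]
    exact hopen g
  let ρ : G →ₜ* Ubar 3 (ZMod m) :=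
    { toMonoidHom := (centralExtension 3 (ZMod m)).rightHom.comp r
      continuous_toFun := by
        refine continuous_iff_continuousAt.2 fun g => ?_
        rw [ContinuousAt, nhds_discrete (Ubar 3 (ZMod m)), Filter.tendsto_pure]
        filter_upwards [hopen g] with h hh
        exact congrArg (centralExtension 3 (ZMod m)).rightHom hh }
  refine ⟨ρ, fun g => ⟨rfl, rfl, rfl⟩, ?_⟩
  exact map_extensionClass_eq_zero _ _ ρ r (fun _ => rfl) hrc

end Unipotent

/-! ## The cochain attached to a corestriction -/

section Induced

variable {m : ℕ} [NeZero m] {G : Type*} [Group G] [TopologicalSpace G] [IsTopologicalGroup G]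

/-- If `χ' : G → ℤ/m` is the corestriction of `ω` from the kernel of `χ`, then `χ ∪ χ'` is the
coboundary of a cochain whose restriction to the kernel of `χ` is the weighted sum of the
conjugates of `ω`. -/
lemma exists_primitive_of_sum_eq (χ χ' : H1 m G) {M : Subgroup G}
    (hM : ∀ g, g ∈ M ↔ χ.1 g = 0) (ω : H1 m M) {σ : G}
    (hmem : ∀ g (i : ZMod m), (σ ^ (i + χ.1 g).val)⁻¹ * g * σ ^ i.val ∈ M)
    (hsum : ∀ g, χ'.1 g = ∑ i : ZMod m, ω.1 ⟨_, hmem g i⟩)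
    (hconj : ∀ (g : M) (i : ZMod m), (σ ^ i.val)⁻¹ * g * σ ^ i.val ∈ M) :
    ∃ φ : G → ZMod m, Continuous φ ∧ (∀ g h, φ (g * h) = φ g + φ h + χ.1 g * χ'.1 h) ∧
      ∀ g : M, φ g = ∑ i : ZMod m, i * ω.1 ⟨_, hconj g i⟩ := by
  have hσ_cont : Continuous fun i : ZMod m => σ ^ i.val := continuous_of_discreteTopology
  have hω : ∀ i, Continuous fun g => ω.1 ⟨_, hmem g i⟩ := fun i =>
    ω.2.1.comp ((((hσ_cont.comp (continuous_const.add χ.2.1)).inv.mul continuous_id).mul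
      continuous_const).subtype_mk _)
  -- The transfer factor of gh at i splits at the intermediate coset σ^(i + χ(h)).
  have hadd : ∀ g h i, ω.1 ⟨_, hmem (g * h) i⟩ =
      ω.1 ⟨_, hmem g (i + χ.1 h)⟩ + ω.1 ⟨_, hmem h i⟩ := by
    intro g h i
    rw [← H1.apply_mul]
    refine congrArg ω.1 (Subtype.ext ?_)
    have : i + χ.1 (g * h) = i + χ.1 h + χ.1 g := by rw [H1.apply_mul]; ring
    simp only [this, Subgroup.coe_mul]
    group
  -- By reindexing, the weighted sum alone satisfies the identity with -χ(h)χ'(g) in place of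
  -- χ(g)χ'(h). The term χ(g)χ'(g) contributes χ(g)χ'(h) + χ(h)χ'(g) and corrects this; it vanishes
  -- on M.
  refine ⟨fun g => χ.1 g * χ'.1 g + ∑ i : ZMod m, i * ω.1 ⟨_, hmem g i⟩,
    (χ.2.1.mul χ'.2.1).add (continuous_finsetSum _ fun i _ => continuous_const.mul (hω i)),
    fun g h => ?_, fun g => ?_⟩
  · beta_reduce
    have h1 : ∑ i : ZMod m, i * ω.1 ⟨_, hmem (g * h) i⟩ =
        ∑ i : ZMod m, i * ω.1 ⟨_, hmem g i⟩ - χ.1 h * χ'.1 g +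
          ∑ i : ZMod m, i * ω.1 ⟨_, hmem h i⟩ := by
      simp only [hadd, mul_add, Finset.sum_add_distrib]
      congr 1
      rw [hsum g, Finset.mul_sum, ← Finset.sum_sub_distrib]
      refine Fintype.sum_equiv (Equiv.addRight (χ.1 h)) _ _ fun i => ?_
      change _ = (i + χ.1 h) * _ - χ.1 h * _
      rw [← sub_mul, add_sub_cancel_right]
      rfl
    rw [h1, H1.apply_mul χ, H1.apply_mul χ']
    ring
  · have hg : χ.1 (g : G) = 0 := (hM _).1 g.2
    simp only [hg, zero_mul, zero_add]
    refine Finset.sum_congr rfl fun i _ => ?_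
    simp only [add_zero]

end Induced

/-! ## Consequences of the axioms of a Kummer formation -/

section Formation

variable {m : ℕ} {G : Type*} [Group G] [TopologicalSpace G]

/-- The whole group as an open normal subgroup. -/
def topOpenNormal (G : Type*) [Group G] [TopologicalSpace G] : OpenNormalSubgroup G where
  toSubgroup := ⊤
  isOpen' := isOpen_univ
  isNormal' := inferInstanceAs (⊤ : Subgroup G).Normal

/-- The kernel of a class in `H¹` as an open normal subgroup. -/
def H1.kerOpenNormal (χ : H1 m G) : OpenNormalSubgroup G where
  toSubgroup := H1.ker χ
  isOpen' := H1.isOpen_ker χ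
  isNormal' := H1.normal_ker χ

/-- The canonical map from `G` to its largest subgroup. -/
def toTop : G →ₜ* (topOpenNormal G).toSubgroup where
  toFun g := ⟨g, trivial⟩
  map_one' := rfl
  map_mul' _ _ := rfl
  continuous_toFun := continuous_id.subtype_mk _

lemma le_topOpenNormal (M : OpenNormalSubgroup G) :
    M.toSubgroup ≤ (topOpenNormal G).toSubgroup := le_top (a := M.toSubgroup)

lemma mem_fixed_top {A : Type*} [AddCommGroup A] [DistribMulAction G A] {a : A}
    (ha : a ∈ fixed A (topOpenNormal G).toSubgroup) (g : G) : g • a = a := ha ⟨g, trivial⟩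

variable [NeZero m]

lemma pow_inv_mul_mul_pow_mem (χ : H1 m G) {σ : G} (hσ : χ.1 σ = 1) (g : G) (i : ZMod m) :
    (σ ^ (i + χ.1 g).val)⁻¹ * g * σ ^ i.val ∈ (H1.kerOpenNormal χ).toSubgroup := by
  refine (H1.mem_ker χ _).2 ?_
  rw [H1.apply_mul, H1.apply_mul, H1.apply_inv, H1.apply_pow, H1.apply_pow, hσ]
  simp

variable [IsTopologicalGroup G] [CompactSpace G]

/-- With the powers of σ as coset representatives, g permutes the cosets by translating the exponent
by χ(g). -/
lemma corLE_top_apply (χ : H1 m G) {σ : G} (hσ : χ.1 σ = 1)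
    (ω : H1 m (H1.kerOpenNormal χ).toSubgroup) (g : G) :
    (corLE (le_topOpenNormal _) ω).1 (toTop g) =
      ∑ i : ZMod m, ω.1 ⟨_, pow_inv_mul_mul_pow_mem χ hσ g i⟩ := by
  refine cor_apply ((H1.kerOpenNormal χ).toSubgroup.subgroupOf (topOpenNormal G).toSubgroup)
    ((H1.kerOpenNormal χ).isOpen'.preimage continuous_subtype_val)
    (H1.map (ofSubgroupOf (le_topOpenNormal _)) ω) (fun i : ZMod m => toTop (σ ^ i.val))
    (bijective_pow_coset χ (M := (H1.kerOpenNormal χ).toSubgroup)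
      (M' := (topOpenNormal G).toSubgroup) trivial hσ
      fun g _ => H1.mem_ker χ g)
    (toTop g) (Equiv.addRight (χ.1 g)) (pow_inv_mul_mul_pow_mem χ hσ g)

variable [TotallyDisconnectedSpace G]
  {A : Type*} [AddCommGroup A] [TopologicalSpace A] [DiscreteTopology A]
  [DistribMulAction G A] [ContinuousSMul G A]

/-- Exactness at H¹ over the whole group: η ∪ χ = 0 forces η to be a corestriction from Ker χ. The
formation sees G only as its top open normal subgroup, hence the transport along `incl`. -/
lemma KummerFormation.exists_corLE_eq (K : KummerFormation m G A) (η χ : H1 m G)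
    (u : G → ZMod m) (huc : Continuous u) (hu : ∀ g h, η.1 g * χ.1 h = u h - u (g * h) + u g) :
    ∃ ω : H1 m (H1.kerOpenNormal χ).toSubgroup,
      corLE (le_topOpenNormal _) ω = H1.map (incl _) η := by
  let i : (topOpenNormal G).toSubgroup →ₜ* G := incl _
  have h0 : cup (H1.map i η) (H1.map i χ) = 0 :=
    (H2.mk_eq_zero_iff _).2 ⟨fun x => u x, huc.comp continuous_subtype_val, fun g h => hu g h⟩
  have h1 := (K.exact_cor_cup (topOpenNormal G) (H1.map i χ) (H1.map i η)).1 h0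
  rw [← range_corLE (le_topOpenNormal (H1.kerOpenNormal χ)) (H1.map i χ)] at h1
  · exact h1
  · ext x
    rw [H1.mem_ker, Subgroup.mem_subgroupOf]
    exact H1.mem_ker χ x

/-- The composite in the exact sequence over M is zero, and L is the kernel of the restriction of χ
to M. -/
lemma KummerFormation.exists_primitive_of_mem_range_corLE (K : KummerFormation m G A)
    {L M : OpenNormalSubgroup G} (hLM : L.toSubgroup ≤ M.toSubgroup) (χ : H1 m G)
    (hL : ∀ g ∈ M.toSubgroup, g ∈ L.toSubgroup ↔ χ.1 g = 0) (ω : H1 m L.toSubgroup) :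
    ∃ u : M.toSubgroup → ZMod m, Continuous u ∧
      ∀ g h : M.toSubgroup, (corLE hLM ω).1 g * χ.1 h = u h - u (g * h) + u g := by
  let i : M.toSubgroup →ₜ* G := incl _
  have h1 : corLE hLM ω ∈ Set.range (corLE (m := m) hLM) := ⟨ω, rfl⟩
  rw [range_corLE hLM (H1.map i χ)] at h1
  · exact (H2.mk_eq_zero_iff _).1 ((K.exact_cor_cup M (H1.map i χ) _).2 h1)
  · ext x
    rw [H1.mem_ker, Subgroup.mem_subgroupOf]
    exact hL x x.2

/-- A `2`-cocycle that is a coboundary on the kernel of `χ` is a cup product with `χ`. -/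
lemma KummerFormation.exists_eq_cup (K : KummerFormation m G A) (χ : H1 m G) (c : Z2 m G)
    (u : (H1.kerOpenNormal χ).toSubgroup → ZMod m) (huc : Continuous u)
    (hu : ∀ g h : (H1.kerOpenNormal χ).toSubgroup, c.1 ((g : G), (h : G)) = u h - u (g * h) + u g) :
    ∃ η : H1 m G, ∃ v : G → ZMod m, Continuous v ∧
      ∀ g h, c.1 (g, h) = η.1 g * χ.1 h + (v h - v (g * h) + v g) := by
  let i : (topOpenNormal G).toSubgroup →ₜ* G := incl _
  have h0 : H2.map (m := m) (incl (H1.ker (H1.map i χ))) (H2.mk (Z2.map i c)) = 0 := by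
    change H2.mk (Z2.map _ _) = 0
    rw [H2.mk_eq_zero_iff]
    exact ⟨fun x => u ⟨x.1.1, (H1.mem_ker χ _).2 ((H1.mem_ker _ _).1 x.2)⟩,
      huc.comp ((continuous_subtype_val.comp continuous_subtype_val).subtype_mk _),
      fun g h => hu ⟨g.1.1, (H1.mem_ker χ _).2 ((H1.mem_ker _ _).1 g.2)⟩
        ⟨h.1.1, (H1.mem_ker χ _).2 ((H1.mem_ker _ _).1 h.2)⟩⟩
  obtain ⟨η, hη⟩ := (K.exact_cup_res (topOpenNormal G) (H1.map i χ) _).1 h0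
  obtain ⟨v, hvc, hv⟩ := (H2.mk_eq_mk_iff _ _).1 hη.symm
  refine ⟨H1.map toTop η, fun g => v (toTop g), hvc.comp toTop.continuous_toFun, fun g h => ?_⟩
  have := hv (toTop g) (toTop h)
  rw [← map_mul] at this
  exact (add_sub_cancel _ _).symm.trans (congrArg _ this)

/-- If `χ₁ ∪ χ₂ = χ₂ ∪ χ₃ = 0`, then `χ₁ ∪ χ₂` is the coboundary of a cochain whose restriction to
the kernel of `χ₁` has trivial cup product with `χ₃`. -/
lemma KummerFormation.exists_primitive (K : KummerFormation m G A) (χ₁ χ₂ χ₃ : H1 m G)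
    (hindep : LinearIndependent (ZMod m) ![χ₁, χ₃])
    (u₁ u₃ : G → ZMod m) (hu₁c : Continuous u₁) (hu₃c : Continuous u₃)
    (hu₁ : ∀ g h, χ₂.1 g * χ₁.1 h = u₁ h - u₁ (g * h) + u₁ g)
    (hu₃ : ∀ g h, χ₂.1 g * χ₃.1 h = u₃ h - u₃ (g * h) + u₃ g) :
    ∃ φ : G → ZMod m, Continuous φ ∧ (∀ g h, φ (g * h) = φ g + φ h + χ₁.1 g * χ₂.1 h) ∧
      ∃ u : (H1.kerOpenNormal χ₁).toSubgroup → ZMod m, Continuous u ∧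
        ∀ g h : (H1.kerOpenNormal χ₁).toSubgroup,
          φ g * χ₃.1 h = u h - u (g * h) + u g := by
  obtain ⟨σ, hσ₁, hσ₃⟩ := exists_apply_eq_of_linearIndependent χ₁ χ₃ hindep 1 0
  obtain ⟨τ, hτ₁, hτ₃⟩ := exists_apply_eq_of_linearIndependent χ₁ χ₃ hindep 0 1
  let T := topOpenNormal G
  let M := H1.kerOpenNormal χ₁
  let N := H1.kerOpenNormal χ₃
  let P := H1.kerOpenNormal (χ₁ - χ₃)
  let L := M ⊓ N
  have hM : ∀ g, g ∈ M.toSubgroup ↔ χ₁.1 g = 0 := H1.mem_ker χ₁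
  have hL : ∀ g, g ∈ L.toSubgroup ↔ χ₁.1 g = 0 ∧ χ₃.1 g = 0 := fun g =>
    and_congr (H1.mem_ker χ₁ g) (H1.mem_ker χ₃ g)
  have hP : ∀ g, g ∈ P.toSubgroup ↔ χ₁.1 g = χ₃.1 g := fun g =>
    (H1.mem_ker _ g).trans sub_eq_zero
  have hLM : L.toSubgroup ≤ M.toSubgroup := fun g hg => hg.1
  have hLP : L.toSubgroup ≤ P.toSubgroup := fun g hg =>
    (hP g).2 (((hL g).1 hg).1.trans ((hL g).1 hg).2.symm)
  obtain ⟨ω, hω⟩ := K.exists_corLE_eq χ₂ χ₁ u₁ hu₁c hu₁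
  obtain ⟨ν, hν⟩ := K.exists_corLE_eq χ₂ χ₃ u₃ hu₃c hu₃
  obtain ⟨α, rfl⟩ := K.surjective _ ω
  obtain ⟨y, rfl⟩ := K.surjective _ ν
  have htM : ∀ a : fixed A M.toSubgroup, (trace M.toSubgroup T.toSubgroup a : A) =
      ∑ i ∈ Finset.range m, σ ^ i • (a : A) := fun a =>
    trace_coe χ₁ (M := M.toSubgroup) (M' := T.toSubgroup) trivial hσ₁ (fun g _ => H1.mem_ker χ₁ g) a
  have htN : (trace N.toSubgroup T.toSubgroup y : A) = ∑ i ∈ Finset.range m, τ ^ i • (y : A) :=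
    trace_coe χ₃ (M := N.toSubgroup) (M' := T.toSubgroup) trivial hτ₃ (fun g _ => H1.mem_ker χ₃ g) y
  -- Both traces have image χ₂ under κ_G, so they differ by m c with c ∈ A^G. The trace of c is m c,
  -- so α - c has the trace of y, and κ_M(α - c) still corestricts to χ₂.
  obtain ⟨α, hα, htr⟩ : ∃ α : fixed A M.toSubgroup,
      corLE (le_topOpenNormal _) (K.κ M α) = H1.map (incl _) χ₂ ∧
      trace M.toSubgroup T.toSubgroup α = trace N.toSubgroup T.toSubgroup y := by
    have h1 : K.κ T (trace M.toSubgroup T.toSubgroup α - trace N.toSubgroup T.toSubgroup y) = 0 := by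
      rw [map_sub, K.cor_comm M T (le_topOpenNormal _), K.cor_comm N T (le_topOpenNormal _), hω, hν,
        sub_self]
    obtain ⟨c, hc⟩ := (K.ker_eq T _).1 h1
    have h2 : trace M.toSubgroup T.toSubgroup
        (α - ⟨c, fixed_anti (le_topOpenNormal M) c.2⟩) = trace N.toSubgroup T.toSubgroup y := by
      rw [map_sub, sub_eq_iff_eq_add, ← sub_eq_iff_eq_add', hc]
      refine Subtype.ext ?_
      rw [htM]
      simp only [mem_fixed_top c.2]
      simp
    refine ⟨_, ?_, h2⟩
    rw [← K.cor_comm M T, h2, K.cor_comm N T (le_topOpenNormal _), hν]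
  obtain ⟨hcyc, hcard⟩ := isCyclic_and_card_of_apply_eq_one χ₁ (M := L.toSubgroup)
    (M' := P.toSubgroup) (σ := σ * τ)
    ((hP _).2 (by rw [H1.apply_mul, H1.apply_mul, hσ₁, hσ₃, hτ₁, hτ₃, add_comm]))
    (by rw [H1.apply_mul, hσ₁, hτ₁, add_zero])
    (fun g hg => by rw [hL, ← (hP g).1 hg, and_self])
  obtain ⟨x, hx, w, hw, hxw⟩ := exists_sum_nsmul_eq_add_trace χ₁ χ₃ hL hP
    (K.tate_vanishing L P hLP hcyc hcard) hσ₁ hσ₃ hτ₁ hτ₃ α.2 y.2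
    (by rw [← htN, ← htr, htM])
  have hconj : ∀ (g : M.toSubgroup) (i : ZMod m),
      (σ ^ i.val)⁻¹ * (g : G) * σ ^ i.val ∈ M.toSubgroup := fun g i => by
    simpa using M.isNormal'.conj_mem g g.2 (σ ^ i.val)⁻¹
  obtain ⟨φ, hφc, hφ, hφM⟩ := exists_primitive_of_sum_eq χ₁ χ₂ (M := M.toSubgroup) hM (K.κ M α)
    (pow_inv_mul_mul_pow_mem χ₁ hσ₁)
    (fun g => (congrArg (fun f => f.1 (toTop g)) hα).symm.trans (corLE_top_apply χ₁ hσ₁ _ g)) hconj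
  replace hx : x ∈ fixed A T.toSubgroup := hx
  let θ : H1 m G := H1.map toTop (K.κ T ⟨x, hx⟩)
  have hκ : ∀ g : M.toSubgroup, φ g = θ.1 g + (corLE hLM (K.κ L ⟨w, hw⟩)).1 g := by
    intro g
    -- Since κ_M is equivariant, applying it to this identity in A^M turns the left side into φ|_M
    -- and the right side into Res κ_G(x) + Cor κ_L(w).
    have e1 : ∑ i ∈ Finset.range m,
        i • (⟨σ ^ i • (α : A), smul_mem_fixed _ α.2⟩ : fixed A M.toSubgroup) =
        ⟨x, fixed_anti (le_topOpenNormal M) hx⟩ + trace L.toSubgroup M.toSubgroup ⟨w, hw⟩ := by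
      refine Subtype.ext ?_
      rw [AddSubgroup.coe_add, trace_coe χ₃ (M := L.toSubgroup) (M' := M.toSubgroup) ((hM _).2 hτ₁) hτ₃
        (fun g hg => by
          rw [hL, (hM g).1 hg]
          simp)]
      rw [AddSubgroup.val_finsetSum]
      exact hxw
    have e2 := congrArg (fun b => (K.κ M b).1 g) e1
    simp only [map_add, map_sum, map_nsmul, K.equivariant] at e2
    rw [K.res_comm M T (le_topOpenNormal M) ⟨x, hx⟩, K.cor_comm L M hLM,
      ← sum_zmod_val (m := m) fun i => i • conj M.toSubgroup (σ ^ i) (K.κ M α)] at e2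
    rw [hφM]
    refine Eq.trans ?_ e2
    rw [AddSubmonoidClass.coe_finsetSum, Finset.sum_apply]
    refine Finset.sum_congr rfl fun i _ => ?_
    change _ = i.val • (conj M.toSubgroup (σ ^ i.val) (K.κ M α)).1 g
    rw [conj_apply, nsmul_eq_mul, ZMod.natCast_zmod_val]
  obtain ⟨u, huc, hu⟩ := K.exists_primitive_of_mem_range_corLE hLM χ₃ (fun g hg => by
    rw [hL, (hM g).1 hg]
    simp) (K.κ L ⟨w, hw⟩)
  refine ⟨fun g => φ g - θ.1 g, hφc.sub θ.2.1, fun g h => ?_, u, huc, fun g h => ?_⟩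
  · beta_reduce
    rw [hφ, H1.apply_mul]
    ring
  · beta_reduce
    rw [← hu, hκ, add_sub_cancel_left]

/-- Triple Massey vanishing over a Kummer formation. -/
theorem KummerFormation.exists_map_alpha_eq_zero (K : KummerFormation m G A) (χ₁ χ₂ χ₃ : H1 m G)
    (hindep : LinearIndependent (ZMod m) ![χ₁, χ₃])
    (hex : ∃ ρ : G →ₜ* Ubar 3 (ZMod m), HasSuperdiagonal ρ χ₁ χ₂ χ₃) :
    ∃ ρ : G →ₜ* Ubar 3 (ZMod m), HasSuperdiagonal ρ χ₁ χ₂ χ₃ ∧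
      H2.map ρ (alpha 3 m) = 0 := by
  obtain ⟨ρ, hρ⟩ := hex
  let f : G → ZMod m := fun g => Ubar.entry 0 2 (by decide) (ρ g)
  let ψ : G → ZMod m := fun g => Ubar.entry 1 3 (by decide) (ρ g)
  have hfc : Continuous f := continuous_of_discreteTopology.comp ρ.continuous_toFun
  have hψc : Continuous ψ := continuous_of_discreteTopology.comp ρ.continuous_toFun
  have hf : ∀ g h, f (g * h) = f g + f h + χ₁.1 g * χ₂.1 h := fun g h => by
    rw [← (hρ g).1, ← (hρ h).2.1, ← Ubar.entry_zero_two_mul, ← map_mul]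
  have hψ : ∀ g h, ψ (g * h) = ψ g + ψ h + χ₂.1 g * χ₃.1 h := fun g h => by
    rw [← (hρ g).2.1, ← (hρ h).2.2, ← Ubar.entry_one_three_mul, ← map_mul]
  -- Subtracting χ₁χ₂ from the (1,3)-entry turns a primitive of -χ₁ ∪ χ₂ into one of χ₂ ∪ χ₁. The
  -- (1,3)-entry of the given ρ is then replaced by φ, while ψ is kept up to a class η.
  obtain ⟨φ, hφc, hφ, u, huc, hu⟩ := K.exists_primitive χ₁ χ₂ χ₃ hindep
    (fun g => f g - χ₁.1 g * χ₂.1 g) (fun g => -ψ g) (hfc.sub (χ₁.2.1.mul χ₂.2.1)) hψc.neg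
    (fun g h => by
      simp only [hf, H1.apply_mul]
      ring)
    (fun g h => by
      simp only [hψ]
      ring)
  let c : Z2 m G := ⟨fun p => χ₁.1 p.1 * ψ p.2 + φ p.1 * χ₃.1 p.2,
    ((χ₁.2.1.comp continuous_fst).mul (hψc.comp continuous_snd)).add
      ((hφc.comp continuous_fst).mul (χ₃.2.1.comp continuous_snd)), fun g h k => by
      simp only [hψ, hφ, H1.apply_mul]
      ring⟩
  -- On Ker χ₁ the term χ₁ ∪ ψ vanishes identically, leaving φ ∪ χ₃.
  obtain ⟨η, v, hvc, hv⟩ := K.exists_eq_cup χ₁ c u huc (fun g h => by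
    rw [← hu]
    change χ₁.1 g * ψ h + φ g * χ₃.1 h = _
    rw [(H1.mem_ker χ₁ _).1 g.2, zero_mul, zero_add])
  -- The product ηχ₁ is the cochain that witnesses η ∪ χ₁ + χ₁ ∪ η = 0 up to sign, so adding η to ψ
  -- cancels the class of c.
  refine exists_hasSuperdiagonal_map_alpha_eq_zero χ₁ χ₂ χ₃ φ (fun g => ψ g + η.1 g)
    (fun g => η.1 g * χ₁.1 g - v g) hφc (hψc.add η.2.1) ((η.2.1.mul χ₁.2.1).sub hvc) hφ
    (fun g h => ?_) (fun g h => ?_)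
  · simp only [hψ, H1.apply_mul]
    ring
  · have := hv g h
    change χ₁.1 g * ψ h + φ g * χ₃.1 h = _ at this
    simp only [H1.apply_mul]
    linear_combination -this

end Formation

end

end KummerMassey

theorem mainTheorem2 (m : ℕ) [NeZero m] (hm : 2 ≤ m)
    (G : Type*) [Group G] [TopologicalSpace G] [IsTopologicalGroup G] [CompactSpace G]
    [TotallyDisconnectedSpace G]
    (A : Type*) [AddCommGroup A] [TopologicalSpace A] [DiscreteTopology A]
    [DistribMulAction G A] [ContinuousSMul G A]
    (_K : KummerMassey.KummerFormation m G A)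
    (χ₁ χ₂ χ₃ : KummerMassey.H1 m G)
    (hindep : LinearIndependent (ZMod m) ![χ₁, χ₃])
    (hex : ∃ ρ : G →ₜ* KummerMassey.Ubar 3 (ZMod m),
      KummerMassey.HasSuperdiagonal ρ χ₁ χ₂ χ₃) :
    ∃ ρ : G →ₜ* KummerMassey.Ubar 3 (ZMod m),
      KummerMassey.HasSuperdiagonal ρ χ₁ χ₂ χ₃ ∧
        KummerMassey.H2.map ρ (KummerMassey.alpha 3 m) = 0 :=
  _K.exists_map_alpha_eq_zero χ₁ χ₂ χ₃ hindep hex
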